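/- Let $G$ be a finite group and $\omega\in Z^3(G,\mathbb{T})$. Recall that an anomalous action of $G$ on a unital C$^*$-algebra $A$ is a pair $(\alpha,u)$ of maps $\alpha:G\to\mathrm{Aut}(A)$, $u:G\times G\to U(A)$ with $\alpha_g\alpha_h=\mathrm{Ad}(u_{g,h})\alpha_{gh}$ and $\alpha_g(u_{h,k})u_{g,hk}u_{gh,k}^*u_{g,h}^*\in\mathbb{T}1_A$; it is a $(G,\omega)$ action if this scalar is $\omega_{g,h,k}$ for all $g,h,k\in G$. It has the Rokhlin property if there are projections $p_g\in A_\infty\cap A'$ ($g\in G$), where $A_\infty=\ell^\infty(\mathbb{N},A)/c_0(\mathbb{N},A)$, with $\sum_{g}p_g=1$ and $\alpha_g(p_h)=p_{gh}$ for all $g,h\in G$. For a $2$-cochain $c$ write $(dc)_{g,h,k}=c_{g,h}c_{gh,k}\overline{c_{g,hk}}\,\overline{c_{h,k}}$. Consider data consisting of a finite group $\Gamma$ whose order divides a power of $|G|$, a surjection $\rho:\Gamma\to G$ with kernel $K$ and a set-theoretic section $g\mapsto\hat g$, a $2$-cochain $\eta:G\times G\to\mathbb{T}$, and a normalised $2$-cochain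 $c:\Gamma\times\Gamma\to\mathbb{T}$ with $c|_{K\times K}=1$ and $dc=\rho^*(\omega\cdot d\eta)$. Let $B=\bigotimes_{i\in\mathbb{N}}\mathcal{B}(\ell^2(\Gamma))$, let $\pi=\mathrm{Ad}(\lambda_\Gamma)^{\otimes\infty}:\Gamma\to\mathrm{Aut}(B)$ with $\lambda_\Gamma$ the left regular representation, and let $B\rtimes_\pi K$ be the reduced crossed product, with canonical unitaries $v_k$, $k\in K$. Then: (i) Such data exist for every $\omega\in Z^3(G,\mathbb{T})$, and with $\eta=1$ if $\omega$ is normalised. (ii) For any such data, $B\rtimes_\pi K$ is $^*$-isomorphic to the UHF algebra $M_{|G|^\infty}=\bigotimes_{i\in\mathbb{N}}\mathcal{B}(\ell^2(G))$. (iii) For any such data and any identification of $B\rtimes_\pi K$ with $M_{|G|^\infty}$, there is exactly one anomalous action $(s_G^\omega,u_G^\omega)$ of $G$ on $M_{|G|^\infty}$ with $$s_G^\omega(g)\Big(\sum_{k\in K}a_kv_k\Big)=\sum_{k\in K}c_{\hat gk\hat g^{-1},\hat g}\,\overline{c_{\hat g,k}}\,\pi_{\hat g}(a_k)v_{\hat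 gk\hat g^{-1}},\qquad u_G^\omega(g,h)=\eta_{g,h}\,\overline{c_{\hat g,\hat h}}\,c_{\kappa,\widehat{gh}}\,v_\kappa,\quad \kappa=\hat g\hat h\widehat{gh}^{-1},$$ for $a_k\in B$ and $g,h\in G$. It is a $(G,\omega)$ action, and it has the Rokhlin property. -/

import Mathlib

open scoped BoundedContinuousFunction

universe u

noncomputable section

namespace Anomalous

/-! ### Cochains with values in the circle -/

/-- `ω ∈ Z³(G, 𝕋)` (trivial coefficients). -/
def IsThreeCocycle {G : Type u} [Group G] (ω : G → G → G → Circle) : Prop :=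
  ∀ g h k l : G,
    ω h k l * ω g (h * k) l * ω g h k = ω (g * h) k l * ω g h (k * l)

/-- A `3`-cochain is normalised if it is `1` as soon as one argument is the identity. -/
def IsNormalized {G : Type u} [Group G] (ω : G → G → G → Circle) : Prop :=
  ∀ g h : G, ω 1 g h = 1 ∧ ω g 1 h = 1 ∧ ω g h 1 = 1

/-- The coboundary of a `2`-cochain, with the sign convention
`(dc)(g,h,k) = c(g,h) c(gh,k) c(g,hk)⁻¹ c(h,k)⁻¹`. -/
def coboundary {G : Type u} [Group G] (c : G → G → Circle) (g h k : G) : Circle :=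
  c g h * c (g * h) k * (c g (h * k))⁻¹ * (c h k)⁻¹

/-! ### Anomalous actions on unital C⋆-algebras -/

/-- An anomalous action `(α, u)` of `G` on a unital C⋆-algebra `A` (so that `M(A) = A`). -/
structure AnomalousAction (G : Type u) [Group G] (A : Type u) [CStarAlgebra A] where
  /-- the automorphisms `α_g` -/
  α : G → (A ≃⋆ₐ[ℂ] A)
  /-- the unitaries `u_{g,h}` -/
  u : G → G → unitary A
  comp_eq : ∀ (g h : G) (a : A),
    α g (α h a) = (u g h : A) * α (g * h) a * star (u g h : A)
  anomaly_scalar : ∀ g h k : G, ∃ z : Circle,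
    α g (u h k : A) * (u g (h * k) : A) * star (u (g * h) k : A) * star (u g h : A)
      = (z : ℂ) • (1 : A)

/-- `(α, u)` is a `(G, ω)` action: its anomaly is `ω`. -/
def AnomalousAction.HasAnomaly {G : Type u} [Group G] {A : Type u} [CStarAlgebra A]
    (S : AnomalousAction G A) (ω : G → G → G → Circle) : Prop :=
  ∀ g h k : G,
    S.α g (S.u h k : A) * (S.u g (h * k) : A) * star (S.u (g * h) k : A) * star (S.u g h : A)
      = (ω g h k : ℂ) • (1 : A)

/-! ### The sequence algebra, central sequences and the Rokhlin property -/

section SequenceAlgebra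

variable (A : Type u) [CStarAlgebra A]

/-- The ideal of null sequences in the algebra `ℕ →ᵇ A` of bounded sequences. -/
def nullSequences : Ideal (ℕ →ᵇ A) where
  carrier := {f | Filter.Tendsto (fun n => f n) Filter.atTop (nhds 0)}
  add_mem' {f g} hf hg := by simpa using Filter.Tendsto.add hf hg
  zero_mem' := by simp
  smul_mem' f g hg := by
    change Filter.Tendsto (fun n => f n * g n) Filter.atTop (nhds 0)
    change Filter.Tendsto (fun n => g n) Filter.atTop (nhds 0) at hg
    have h0 : Filter.Tendsto (fun n => ‖f‖ * ‖g n‖) Filter.atTop (nhds 0) := by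
      simpa using (tendsto_zero_iff_norm_tendsto_zero.1 hg).const_mul ‖f‖
    refine squeeze_zero_norm (fun n => (norm_mul_le _ _).trans ?_) h0
    exact mul_le_mul_of_nonneg_right (f.norm_coe_le_norm n) (norm_nonneg _)

theorem mem_nullSequences {f : ℕ →ᵇ A} :
    f ∈ nullSequences A ↔ Filter.Tendsto (fun n => f n) Filter.atTop (nhds 0) := Iff.rfl

instance : (nullSequences A).IsTwoSided where
  mul_mem_of_left {f} g hf := by
    rw [mem_nullSequences] at hf ⊢
    have h0 : Filter.Tendsto (fun n => ‖f n‖ * ‖g‖) Filter.atTop (nhds 0) := by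
      simpa using (tendsto_zero_iff_norm_tendsto_zero.1 hf).mul_const ‖g‖
    refine squeeze_zero_norm (fun n => (norm_mul_le _ _).trans ?_) h0
    exact mul_le_mul_of_nonneg_left (g.norm_coe_le_norm n) (norm_nonneg _)

/-- `A_∞`: bounded sequences modulo null sequences. -/
def SeqAlg : Type u := (ℕ →ᵇ A) ⧸ nullSequences A

instance : Ring (SeqAlg A) := inferInstanceAs (Ring ((ℕ →ᵇ A) ⧸ nullSequences A))

/-- The class of a bounded sequence in `A_∞`. -/
def SeqAlg.mk : (ℕ →ᵇ A) →+* SeqAlg A := Ideal.Quotient.mk (nullSequences A)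

theorem star_mem_nullSequences {f : ℕ →ᵇ A} (hf : f ∈ nullSequences A) :
    star f ∈ nullSequences A := by
  rw [mem_nullSequences] at hf ⊢
  simpa using hf.star

/-- The involution of `A_∞`, induced by the pointwise one. -/
instance : Star (SeqAlg A) where
  star := Quotient.map' (s₁ := Submodule.quotientRel (nullSequences A))
    (s₂ := Submodule.quotientRel (nullSequences A)) star (fun f g h => by
      rw [Submodule.quotientRel_def] at h ⊢
      rw [← star_sub]
      exact star_mem_nullSequences A h)

variable {A}

theorem SeqAlg.star_mk (f : ℕ →ᵇ A) : star (SeqAlg.mk A f) = SeqAlg.mk A (star f) := rfl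

/-- The entrywise application of an automorphism to bounded sequences. -/
def boundedMap (θ : A ≃⋆ₐ[ℂ] A) : (ℕ →ᵇ A) →+* (ℕ →ᵇ A) where
  toFun f := BoundedContinuousFunction.ofNormedAddCommGroupDiscrete (fun n => θ (f n)) ‖f‖
    (fun n => (NonUnitalStarAlgHom.norm_apply_le θ (f n)).trans (f.norm_coe_le_norm n))
  map_one' := by ext n; simp
  map_mul' f g := by ext n; simp
  map_zero' := by ext n; simp
  map_add' f g := by ext n; simp

theorem boundedMap_mem (θ : A ≃⋆ₐ[ℂ] A) {f : ℕ →ᵇ A} (hf : f ∈ nullSequences A) :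
    boundedMap θ f ∈ nullSequences A := by
  rw [mem_nullSequences] at hf ⊢
  exact squeeze_zero_norm (fun n => NonUnitalStarAlgHom.norm_apply_le θ (f n))
    (tendsto_zero_iff_norm_tendsto_zero.1 hf)

/-- The map induced on `A_∞` by an automorphism of `A`. -/
def SeqAlg.map (θ : A ≃⋆ₐ[ℂ] A) : SeqAlg A →+* SeqAlg A :=
  Ideal.Quotient.lift (nullSequences A) ((SeqAlg.mk A).comp (boundedMap θ)) (fun _ hf =>
    Ideal.Quotient.eq_zero_iff_mem.2 (boundedMap_mem θ hf))

variable (A)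

/-- The central sequence algebra `F(A) = A_∞ ∩ A'`. As `A` is unital, the annihilator of `A` in
`A_∞` is zero, so that no quotient has to be taken. -/
def centralSequences : Subring (SeqAlg A) :=
  Subring.centralizer
    (Set.range fun a : A => SeqAlg.mk A (BoundedContinuousFunction.const ℕ a))

variable {A}

/-- The Rokhlin property of an anomalous action of a finite group on a unital C⋆-algebra. -/
def AnomalousAction.HasRokhlinProperty {G : Type u} [Group G] [Fintype G]
    (S : AnomalousAction G A) : Prop :=
  ∃ p : G → SeqAlg A,
    (∀ g, p g ∈ centralSequences A) ∧ (∀ g, IsStarProjection (p g)) ∧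
      ∑ g, p g = 1 ∧ ∀ g h, SeqAlg.map (S.α g) (p h) = p (g * h)

end SequenceAlgebra

/-! ### Generated C⋆-algebras and conjugation by unitaries -/

section Conjugation

variable {M : Type u} [CStarAlgebra M]

/-- The C⋆-algebra generated by a subset of a unital C⋆-algebra (with the unit): the norm closure of
the unital `⋆`-algebra that it generates. -/
def generated (s : Set M) : StarSubalgebra ℂ M :=
  (StarAlgebra.adjoin ℂ s).topologicalClosure

theorem isClosed_generated (s : Set M) : IsClosed (generated s : Set M) :=
  StarSubalgebra.isClosed_topologicalClosure _

theorem subset_generated (s : Set M) {b : M} (hb : b ∈ s) : b ∈ generated s :=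
  StarSubalgebra.le_topologicalClosure _ (StarAlgebra.subset_adjoin ℂ s hb)

theorem conj_mem_of_generators (w : unitary M) (s : Set M)
    (h : ∀ b ∈ s, Unitary.conjStarAlgAut ℂ M w b ∈ s) (b : M) (hb : b ∈ generated s) :
    Unitary.conjStarAlgAut ℂ M w b ∈ generated s := by
  let f : M →⋆ₐ[ℂ] M := (Unitary.conjStarAlgAut ℂ M w : M →⋆ₐ[ℂ] M)
  have hf : Continuous f := by
    change Continuous fun b : M => (w : M) * b * star (w : M)
    fun_prop
  have hle : generated s ≤ (generated s).comap f := by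
    refine StarSubalgebra.topologicalClosure_minimal (StarAlgebra.adjoin_le ?_)
      ((isClosed_generated s).preimage hf)
    exact fun b hb => subset_generated s (h b hb)
  exact hle hb

/-- A group of unitaries acts by conjugation on every `⋆`-subalgebra that it leaves invariant. -/
def conjAction {Γ : Type u} [Group Γ] (N : StarSubalgebra ℂ M) (W : Γ →* unitary M)
    (hN : ∀ γ, ∀ b ∈ N, Unitary.conjStarAlgAut ℂ M (W γ) b ∈ N) : Γ →* (N ≃⋆ₐ[ℂ] N) where
  toFun γ :=
    { toFun := fun b => ⟨Unitary.conjStarAlgAut ℂ M (W γ) b, hN γ b b.2⟩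
      invFun := fun b => ⟨Unitary.conjStarAlgAut ℂ M (W γ⁻¹) b, hN γ⁻¹ b b.2⟩
      left_inv := fun b => Subtype.ext (by
        change (Unitary.conjStarAlgAut ℂ M (W γ⁻¹) * Unitary.conjStarAlgAut ℂ M (W γ)) b.1 = b.1
        rw [← map_mul, ← map_mul, inv_mul_cancel, map_one, map_one]; rfl)
      right_inv := fun b => Subtype.ext (by
        change (Unitary.conjStarAlgAut ℂ M (W γ) * Unitary.conjStarAlgAut ℂ M (W γ⁻¹)) b.1 = b.1
        rw [← map_mul, ← map_mul, mul_inv_cancel, map_one, map_one]; rfl)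
      map_mul' := fun a b => Subtype.ext (map_mul _ a.1 b.1)
      map_add' := fun a b => Subtype.ext (map_add _ a.1 b.1)
      map_star' := fun a => Subtype.ext (map_star _ a.1)
      map_smul' := fun z a => Subtype.ext (map_smul _ z a.1) }
  map_one' := by
    ext b
    change Unitary.conjStarAlgAut ℂ M (W 1) b.1 = b.1
    rw [map_one, map_one]; rfl
  map_mul' γ δ := by
    ext b
    change Unitary.conjStarAlgAut ℂ M (W (γ * δ)) b.1 = _
    rw [map_mul, map_mul]; rfl

end Conjugation

/-! ### The infinite tensor product of matrix algebras -/

section InfiniteTensor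

variable (Γ : Type u)

/-- The Hilbert space `ℓ²(Γ^ℕ)` of the discrete set `Γ^ℕ`. -/
abbrev TensorSpace : Type u := lp (fun _ : ℕ → Γ => ℂ) 2

variable {Γ}

theorem memlp_comp_perm (e : Equiv.Perm (ℕ → Γ)) (ξ : TensorSpace Γ) :
    Memℓp (fun x => ξ (e x)) 2 := by
  have h := lp.memℓp ξ
  have h2 : 0 < (2 : ENNReal).toReal := by simp
  rw [memℓp_gen_iff h2] at h ⊢
  exact (e.summable_iff (f := fun x => ‖ξ x‖ ^ (2 : ENNReal).toReal)).2 h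

/-- Composition with a permutation of the index set, as a unitary operator on `ℓ²`. -/
def permOp (e : Equiv.Perm (ℕ → Γ)) : TensorSpace Γ ≃ₗᵢ[ℂ] TensorSpace Γ where
  toFun ξ := ⟨fun x => ξ (e x), memlp_comp_perm e ξ⟩
  invFun ξ := ⟨fun x => ξ (e.symm x), memlp_comp_perm e.symm ξ⟩
  map_add' ξ η := by ext x; rfl
  map_smul' z ξ := by ext x; rfl
  left_inv ξ := by
    ext x
    change ξ (e (e.symm x)) = ξ x
    simp
  right_inv ξ := by
    ext x
    change ξ (e.symm (e x)) = ξ x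
    simp
  norm_map' ξ := by
    have h2 : 0 < (2 : ENNReal).toReal := by simp
    rw [lp.norm_eq_tsum_rpow h2, lp.norm_eq_tsum_rpow h2]
    congr 1
    exact e.tsum_eq (fun x => ‖ξ x‖ ^ (2 : ENNReal).toReal)

@[simp] theorem permOp_apply (e : Equiv.Perm (ℕ → Γ)) (ξ : TensorSpace Γ) (x : ℕ → Γ) :
    permOp e ξ x = ξ (e x) := rfl

theorem memlp_mul (a : (ℕ → Γ) → ℂ) (C : ℝ) (ha : ∀ x, ‖a x‖ ≤ C) (ξ : TensorSpace Γ) :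
    Memℓp (fun x => a x * ξ x) 2 := by
  have h2 : 0 < (2 : ENNReal).toReal := by simp
  have h : Memℓp (fun x => (C : ℂ) * ξ x) 2 := lp.memℓp ((C : ℂ) • ξ)
  rw [memℓp_gen_iff h2] at h ⊢
  refine h.of_nonneg_of_le (fun x => by positivity) (fun x => ?_)
  have hC : 0 ≤ C := (norm_nonneg _).trans (ha x)
  refine Real.rpow_le_rpow (norm_nonneg _) ?_ h2.le
  rw [norm_mul, norm_mul, Complex.norm_real, Real.norm_of_nonneg hC]
  exact mul_le_mul_of_nonneg_right (ha x) (norm_nonneg _)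

theorem norm_mul_le_of_bound (a : (ℕ → Γ) → ℂ) (C : ℝ) (hC : 0 ≤ C) (ha : ∀ x, ‖a x‖ ≤ C)
    (ξ : TensorSpace Γ) :
    ‖(⟨fun x => a x * ξ x, memlp_mul a C ha ξ⟩ : TensorSpace Γ)‖ ≤ C * ‖ξ‖ := by
  have h2 : 0 < (2 : ENNReal).toReal := by simp
  have h : C * ‖ξ‖ = ‖(C : ℂ) • ξ‖ := by
    rw [norm_smul, Complex.norm_real, Real.norm_of_nonneg hC]
  rw [h]
  refine lp.norm_mono (by simp) (fun x => ?_)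
  change ‖a x * ξ x‖ ≤ ‖(C : ℂ) * ξ x‖
  rw [norm_mul, norm_mul, Complex.norm_real, Real.norm_of_nonneg hC]
  exact mul_le_mul_of_nonneg_right (ha x) (norm_nonneg _)

/-- Multiplication by a bounded function. -/
def mulOp (a : (ℕ → Γ) → ℂ) (C : ℝ) (hC : 0 ≤ C) (ha : ∀ x, ‖a x‖ ≤ C) :
    TensorSpace Γ →L[ℂ] TensorSpace Γ :=
  LinearMap.mkContinuous
    { toFun := fun ξ => ⟨fun x => a x * ξ x, memlp_mul a C ha ξ⟩
      map_add' := fun ξ η => by ext x; exact mul_add _ _ _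
      map_smul' := fun z ξ => by ext x; exact mul_left_comm _ _ _ }
    C (norm_mul_le_of_bound a C hC ha)

@[simp] theorem mulOp_apply (a : (ℕ → Γ) → ℂ) (C : ℝ) (hC : 0 ≤ C) (ha : ∀ x, ‖a x‖ ≤ C)
    (ξ : TensorSpace Γ) (x : ℕ → Γ) : mulOp a C hC ha ξ x = a x * ξ x := rfl

theorem entry_le [Fintype Γ] (T : Matrix Γ Γ ℂ) (a b : Γ) : ‖T a b‖ ≤ ∑ a, ∑ b, ‖T a b‖ :=
  (Finset.single_le_sum (f := fun b => ‖T a b‖) (fun _ _ => norm_nonneg _)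
    (Finset.mem_univ b)).trans
    (Finset.single_le_sum (f := fun a => ∑ b, ‖T a b‖)
      (fun _ _ => Finset.sum_nonneg fun _ _ => norm_nonneg _) (Finset.mem_univ a))

variable [Group Γ]

/-- The permutation of `Γ^ℕ` that multiplies the `i`-th coordinate by `γ` on the left. -/
def coordPerm (i : ℕ) (γ : Γ) : Equiv.Perm (ℕ → Γ) where
  toFun x := Function.update x i (γ * x i)
  invFun x := Function.update x i (γ⁻¹ * x i)
  left_inv x := by simp
  right_inv x := by simp

/-- The left translation of all coordinates by `γ`. -/
def diagPerm (γ : Γ) : Equiv.Perm (ℕ → Γ) where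
  toFun x := fun i => γ * x i
  invFun x := fun i => γ⁻¹ * x i
  left_inv x := by simp
  right_inv x := by simp

/-- The unitary `λ_Γ(γ)^{⊗∞}` on `ℓ²(Γ^ℕ)`: `(W_γ ξ)(x) = ξ(γ⁻¹ x)`. -/
def diagShift : Γ →* unitary (TensorSpace Γ →L[ℂ] TensorSpace Γ) :=
  (Unitary.linearIsometryEquiv (𝕜 := ℂ) (H := TensorSpace Γ)).symm.toMonoidHom.comp
    { toFun := fun γ : Γ => permOp (diagPerm γ⁻¹)
      map_one' := by
        ext ξ x
        change ξ (fun i => (1 : Γ)⁻¹ * x i) = ξ x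
        simp
      map_mul' := fun γ δ => by
        ext ξ x
        change ξ (fun i => (γ * δ)⁻¹ * x i) = ξ (fun i => δ⁻¹ * (γ⁻¹ * x i))
        simp [mul_assoc] }

theorem diagShift_apply (γ : Γ) (ξ : TensorSpace Γ) (x : ℕ → Γ) :
    (diagShift γ : TensorSpace Γ →L[ℂ] TensorSpace Γ) ξ x = ξ (fun i => γ⁻¹ * x i) := rfl

variable [Fintype Γ]

/-- The operator `r_i(T)` on `ℓ²(Γ^ℕ)` that acts as the matrix `T ∈ M_Γ(ℂ) = 𝓑(ℓ²(Γ))` on the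
`i`-th coordinate, `(r_i(T) ξ)(x) = ∑_γ T(x_i, γ) ξ(x with x_i replaced by γ)`; see `site_apply`. -/
def site (i : ℕ) (T : Matrix Γ Γ ℂ) : TensorSpace Γ →L[ℂ] TensorSpace Γ :=
  ∑ γ : Γ, (mulOp (fun x => T (x i) (γ * x i)) (∑ a, ∑ b, ‖T a b‖)
      (Finset.sum_nonneg fun _ _ => Finset.sum_nonneg fun _ _ => norm_nonneg _)
      (fun _ => entry_le T _ _)).comp
    ((permOp (coordPerm i γ)).toContinuousLinearEquiv : TensorSpace Γ →L[ℂ] TensorSpace Γ)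

theorem site_apply (i : ℕ) (T : Matrix Γ Γ ℂ) (ξ : TensorSpace Γ) (x : ℕ → Γ) :
    site i T ξ x = ∑ γ : Γ, T (x i) γ * ξ (Function.update x i γ) := by
  rw [← Equiv.sum_comp (Equiv.mulRight (x i))]
  simp only [site, sum_apply, lp.coeFn_sum, Finset.sum_apply]
  rfl

variable (Γ)

/-- The C⋆-algebra `⨂_{i ∈ ℕ} 𝓑(ℓ²(Γ))`, realised on `ℓ²(Γ^ℕ)` as the norm closure of the
`⋆`-algebra generated by all `r_i(T)`. -/
def tensorAlgebra : StarSubalgebra ℂ (TensorSpace Γ →L[ℂ] TensorSpace Γ) :=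
  generated {b | ∃ (i : ℕ) (T : Matrix Γ Γ ℂ), b = site i T}

/-- The UHF algebra `M_{|Γ|^∞} = ⨂_{i ∈ ℕ} 𝓑(ℓ²(Γ))`. -/
def UHF : Type u := tensorAlgebra Γ

instance : CStarAlgebra (UHF Γ) :=
  haveI : IsClosed (tensorAlgebra Γ : Set (TensorSpace Γ →L[ℂ] TensorSpace Γ)) :=
    isClosed_generated _
  inferInstanceAs (CStarAlgebra (tensorAlgebra Γ))

instance : PartialOrder (UHF Γ) := CStarAlgebra.spectralOrder _

instance : StarOrderedRing (UHF Γ) := CStarAlgebra.spectralOrderedRing _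

variable {Γ}

/-- `λ_Γ(γ)^{⊗∞} r_i(T) (λ_Γ(γ)^{⊗∞})* = r_i(λ_Γ(γ) T λ_Γ(γ)*)`. -/
theorem conj_site (γ : Γ) (i : ℕ) (T : Matrix Γ Γ ℂ) :
    Unitary.conjStarAlgAut ℂ (TensorSpace Γ →L[ℂ] TensorSpace Γ) (diagShift γ) (site i T)
      = site i (Matrix.of fun a b => T (γ⁻¹ * a) (γ⁻¹ * b)) := by
  rw [Unitary.conjStarAlgAut_apply, ← Unitary.coe_star, Unitary.star_eq_inv, ← map_inv]
  ext ξ x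
  simp only [mul_apply_eq_comp, diagShift_apply, site_apply, inv_inv, Matrix.of_apply]
  rw [← Equiv.sum_comp (Equiv.mulLeft γ⁻¹)]
  refine Finset.sum_congr rfl fun δ _ => ?_
  simp only [Equiv.coe_mulLeft]
  congr 1
  refine congrArg ξ ?_
  funext j
  by_cases hj : j = i
  · subst hj; simp
  · simp [hj]

theorem conj_mem (γ : Γ) (b : TensorSpace Γ →L[ℂ] TensorSpace Γ) (hb : b ∈ tensorAlgebra Γ) :
    Unitary.conjStarAlgAut ℂ (TensorSpace Γ →L[ℂ] TensorSpace Γ) (diagShift γ) b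
      ∈ tensorAlgebra Γ := by
  refine conj_mem_of_generators (diagShift γ) _ ?_ b hb
  rintro _ ⟨i, T, rfl⟩
  exact ⟨i, Matrix.of fun a b => T (γ⁻¹ * a) (γ⁻¹ * b), conj_site γ i T⟩

/-- The action `π = Ad(λ_Γ)^{⊗∞}` of `Γ` on `⨂_{i ∈ ℕ} 𝓑(ℓ²(Γ))`. -/
def tensorAction : Γ →* (UHF Γ ≃⋆ₐ[ℂ] UHF Γ) :=
  conjAction (tensorAlgebra Γ) diagShift conj_mem

end InfiniteTensor

/-! ### Reduced crossed products by finite groups -/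

section CrossedProduct

variable {K : Type u} [Group K] [Fintype K] [DecidableEq K]
variable {B : Type u} [CStarAlgebra B] [PartialOrder B] [StarOrderedRing B]

/-- The regular representation of `B` on the Hilbert module `ℓ²(K, B)`, whose algebra of adjointable
operators is `M_K(B)`: `(b ξ)(s) = π_{s⁻¹}(b) ξ(s)`. -/
def regularRep (π : K →* (B ≃⋆ₐ[ℂ] B)) (b : B) : CStarMatrix K K B :=
  CStarMatrix.ofMatrix (Matrix.diagonal fun s => π s⁻¹ b)

/-- The translation unitaries on `ℓ²(K, B)`: `(v_k ξ)(s) = ξ(k⁻¹ s)`. -/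
def translation (B : Type u) [CStarAlgebra B] (k : K) : CStarMatrix K K B :=
  CStarMatrix.ofMatrix (Matrix.of fun s t => if s = k * t then 1 else 0)

/-- The reduced crossed product `B ⋊_π K`: the C⋆-algebra generated by `B` and the translation
unitaries on `ℓ²(K, B)`. -/
def crossedProduct (π : K →* (B ≃⋆ₐ[ℂ] B)) : StarSubalgebra ℂ (CStarMatrix K K B) :=
  generated (Set.range (regularRep π) ∪ Set.range (translation (K := K) B))

/-- The canonical copy of `b ∈ B` in `B ⋊_π K`. -/
def crossedProduct.of (π : K →* (B ≃⋆ₐ[ℂ] B)) (b : B) : crossedProduct π :=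
  ⟨regularRep π b, subset_generated _ (Or.inl ⟨b, rfl⟩)⟩

/-- The canonical unitaries `v_k ∈ B ⋊_π K`. -/
def crossedProduct.v (π : K →* (B ≃⋆ₐ[ℂ] B)) (k : K) : crossedProduct π :=
  ⟨translation B k, subset_generated _ (Or.inr ⟨k, rfl⟩)⟩

end CrossedProduct

/-! ### The model actions -/

/-- The data from which a model `(G, ω)` action is built: a finite group `Γ` whose order divides a
power of `|G|`, a surjection `ρ : Γ → G` with a set theoretic section `g ↦ ĝ`, and a normalised
`2`-cochain `c` on `Γ`, trivial on `ker ρ`, whose coboundary is the pull back of a (necessarily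
normalised) cocycle `ω · dη` cohomologous to `ω`. For normalised `ω` one may take `η = 1`, which
gives `dc = ρ^*(ω)`. -/
structure ModelData (G : Type u) [Group G] [Fintype G] (ω : G → G → G → Circle) where
  Γ : Type u
  [group : Group Γ]
  [fintype : Fintype Γ]
  card_dvd : ∃ m : ℕ, Fintype.card Γ ∣ Fintype.card G ^ m
  ρ : Γ →* G
  /-- the section `g ↦ ĝ` -/
  sec : G → Γ
  ρ_sec : ∀ g, ρ (sec g) = g
  η : G → G → Circle
  c : Γ → Γ → Circle
  c_one_left : ∀ x, c 1 x = 1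
  c_one_right : ∀ x, c x 1 = 1
  c_ker : ∀ k l, k ∈ ρ.ker → l ∈ ρ.ker → c k l = 1
  coboundary_c : ∀ x y z : Γ,
    coboundary c x y z = ω (ρ x) (ρ y) (ρ z) * coboundary η (ρ x) (ρ y) (ρ z)

namespace ModelData

variable {G : Type u} [Group G] [Fintype G] {ω : G → G → G → Circle} (D : ModelData G ω)

instance : Group D.Γ := D.group

instance : Fintype D.Γ := D.fintype

/-- The group `K = ker ρ`. -/
def K : Type u := D.ρ.ker

instance : Group D.K := inferInstanceAs (Group D.ρ.ker)

instance : Fintype D.K :=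
  haveI : Finite D.K := inferInstanceAs (Finite D.ρ.ker)
  Fintype.ofFinite _

instance : DecidableEq D.K := Classical.decEq _

/-- The inclusion of `K` in `Γ`. -/
def incl : D.K →* D.Γ := D.ρ.ker.subtype

/-- The restriction of `π = Ad(λ_Γ)^{⊗∞}` to `K`. -/
def π : D.K →* (UHF D.Γ ≃⋆ₐ[ℂ] UHF D.Γ) := tensorAction.comp D.incl

/-- The crossed product `A = B ⋊_π K` with `B = ⨂_{i ∈ ℕ} 𝓑(ℓ²(Γ))`. -/
abbrev Alg : Type u := crossedProduct D.π

/-- The element `∑_k a_k v_k` of the crossed product. -/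
def elt (a : D.K → UHF D.Γ) : D.Alg :=
  ∑ k, crossedProduct.of D.π (a k) * crossedProduct.v D.π k

/-- The element `ĝ k ĝ⁻¹` of `K`. -/
def conj (g : G) (k : D.K) : D.K :=
  ⟨D.sec g * D.incl k * (D.sec g)⁻¹, D.ρ.normal_ker.conj_mem _ k.2 _⟩

/-- The element `ĝ ĥ (gh)^⁻¹` of `K`. -/
def defect (g h : G) : D.K :=
  ⟨D.sec g * D.sec h * (D.sec (g * h))⁻¹, by simp [MonoidHom.mem_ker, D.ρ_sec]⟩

/-- The right-hand side of the formula for the model automorphism at `g`, namely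
`∑_k c(ĝkĝ⁻¹, ĝ) conj(c(ĝ, k)) π_ĝ(a_k) v_{ĝkĝ⁻¹}`. -/
def autFormula (g : G) (a : D.K → UHF D.Γ) : D.Alg :=
  ∑ k, ((D.c (D.incl (D.conj g k)) (D.sec g) * (D.c (D.sec g) (D.incl k))⁻¹ : Circle) : ℂ) •
    (crossedProduct.of D.π (tensorAction (D.sec g) (a k)) * crossedProduct.v D.π (D.conj g k))

/-- The model unitary
`η(g,h) conj(c(ĝ, ĥ)) c(κ, (gh)^) v_κ` with `κ = ĝ ĥ (gh)^⁻¹`. -/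
def unitaryFormula (g h : G) : D.Alg :=
  ((D.η g h * (D.c (D.sec g) (D.sec h))⁻¹ *
      D.c (D.incl (D.defect g h)) (D.sec (g * h)) : Circle) : ℂ) •
    crossedProduct.v D.π (D.defect g h)

/-- `S` is the model action `(s_G^ω, u_G^ω)` on `M_{|G|^∞}` given by the data `D` and the
identification `φ` of `B ⋊_π K` with `M_{|G|^∞}`. -/
def IsModelAction (φ : D.Alg ≃⋆ₐ[ℂ] UHF G) (S : AnomalousAction G (UHF G)) : Prop :=
  (∀ (g : G) (a : D.K → UHF D.Γ), S.α g (φ (D.elt a)) = φ (D.autFormula g a)) ∧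
    ∀ g h : G, (S.u g h : UHF G) = φ (D.unitaryFormula g h)

end ModelData

end Anomalous

end

noncomputable section

namespace Anomalous

/-! ### Existence of model data -/

/-! Existence of data. After `ω` is normalised by a coboundary, multiplying the cocycle identity
over the last variable shows that `ω ^ |G|` is the coboundary of `A(g,h) = ∏ₖ ω(g,h,k)`. Dividing
`ω` by the coboundary of a `|G|`-th root `a` of `A` leaves a cocycle `w` with values in the `|G|`-th
roots of unity (`pow_card_eq`). Such a `w` becomes a coboundary on an extension of `G` by a finite
group of functions `f : G → μ_{|G|}`, the trivialising cochain being evaluation of these functions.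
The order of the extension divides `|G|^(|G|+1)`.

Identification of the algebra. The crossed product acts on `ℓ²(Γ^ℕ)`, each `v_k` translating all
coordinates by `k`. This is faithful because `a v_k` sends a basis vector at `y` into the tail class
of `k y`, and these classes differ for different `k` (`spatialRep_injective`). Given a left
`K`-equivariant map `s : Γ → K`, the coordinates `y₀ = x₀`, `y_{i+1} = s(x_i)⁻¹ x_{i+1}` turn the
diagonal translation into a translation of `y₀` alone. The crossed product thereby becomes exactly
the algebra generated by matrices in single `y`-coordinates, that is, `⨂ 𝓑(ℓ²(Γ))`. Finally `|G|`
divides `|Γ|`, which divides a power of `|G|`, so a bijection `Γ^ℕ ≃ G^ℕ` compatible with initial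
segments and tails identifies the UHF algebras of `Γ` and `G` (`LocallyEquiv.of_card_dvd`).

The action. As `dc` is pulled back from `G` and `c` is normalised, `c` satisfies the `2`-cocycle
identity whenever one argument lies in `K` (`c_assoc`). With `c = 1` on `K × K` this makes the
formula a covariant representation, hence an automorphism, and gives the composition rule. The
scalar left over in the anomaly is `dc = ω · dη` at the chosen lifts (`defect_scalar`), and the
factors `η` of the unitaries remove `dη`. Uniqueness holds because every element is a sum `∑ a_k
v_k`.

The Rokhlin projections are the indicators of `ρ(x_n) = g` as `n → ∞`. They eventually commute with
each fixed tensor factor, `K` fixes them, and `ĝ` permutes them by left translation on `G`. -/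

/-- An `n`-th root on the circle, with value `1` at `1`. -/
def circleRoot (n : ℕ) (z : Circle) : Circle := Circle.exp (Complex.arg z / n)

theorem circleRoot_one (n : ℕ) : circleRoot n 1 = 1 := by simp [circleRoot]

theorem circleRoot_pow {n : ℕ} (hn : n ≠ 0) (z : Circle) : circleRoot n z ^ n = z := by
  rw [circleRoot, ← Circle.exp_nsmul, nsmul_eq_mul, mul_div_cancel₀ _ (by exact_mod_cast hn),
    Circle.exp_arg]

/-! ### Normalising a `3`-cocycle and reducing it to roots of unity. -/

section Normalization

variable {G : Type u} [Group G]

theorem isThreeCocycle_coboundary (a : G → G → Circle) : IsThreeCocycle (coboundary a) := by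
  intro g h k l
  simp only [coboundary, mul_assoc]
  apply Additive.ofMul.injective
  simp only [ofMul_mul, ofMul_inv]
  abel

theorem IsThreeCocycle.mul {ω ω' : G → G → G → Circle} (h : IsThreeCocycle ω)
    (h' : IsThreeCocycle ω') : IsThreeCocycle fun g h k => ω g h k * ω' g h k := by
  intro a b c d
  beta_reduce
  rw [mul_mul_mul_comm (ω b c d), mul_mul_mul_comm (ω b c d * _), h a b c d, h' a b c d,
    mul_mul_mul_comm]

theorem IsThreeCocycle.inv {ω : G → G → G → Circle} (h : IsThreeCocycle ω) :
    IsThreeCocycle fun g h k => (ω g h k)⁻¹ := by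
  intro a b c d
  rw [← mul_inv, ← mul_inv, h a b c d, mul_inv]

theorem IsNormalized.coboundary {a : G → G → Circle} (h1 : ∀ g, a 1 g = 1)
    (h2 : ∀ g, a g 1 = 1) : IsNormalized (coboundary a) := by
  intro g h
  simp [Anomalous.coboundary, h1, h2]

open Classical in
/-- The `2`-cochain by which a `3`-cocycle is normalised. -/
def normalizer (ω : G → G → G → Circle) (g h : G) : Circle :=
  if h = 1 then (ω g 1 1)⁻¹ else if g = 1 then ω 1 1 h else 1

theorem normalizer_eq_one {ω : G → G → G → Circle} (hω : IsNormalized ω) (g h : G) :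
    normalizer ω g h = 1 := by
  unfold normalizer
  split_ifs
  · rw [(hω g 1).2.2, inv_one]
  · exact (hω 1 h).1
  · rfl

theorem isNormalized_of_middle {ω : G → G → G → Circle} (hω : IsThreeCocycle ω)
    (h : ∀ g k, ω g 1 k = 1) : IsNormalized ω := by
  refine fun g k => ⟨?_, h g k, ?_⟩
  · have h1 := hω 1 1 g k
    simpa [h] using h1
  · have h1 := hω g k 1 1
    simpa [h] using h1

/-- Only the middle argument has to be treated, by `isNormalized_of_middle`. The coboundary at
`(g,1,k)` is `ω(g,1,1)⁻¹ ω(1,1,k)⁻¹`, while the cocycle identity at `(g,1,1,k)` reads `ω(g,1,k) =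
ω(1,1,k) ω(g,1,1)`. -/
theorem isNormalized_mul_normalizer {ω : G → G → G → Circle} (hω : IsThreeCocycle ω) :
    IsNormalized fun g h k => ω g h k * coboundary (normalizer ω) g h k := by
  refine isNormalized_of_middle (hω.mul (isThreeCocycle_coboundary _)) fun g k => ?_
  have h0 := hω 1 1 1 1
  have h1 := hω g 1 1 k
  have hl : normalizer ω 1 k = ω 1 1 k := by
    unfold normalizer
    split_ifs with hk
    -- The two clauses of `normalizer` overlap at `(1,1)`; they agree there because `ω(1,1,1) = 1`.
    · subst hk
      simp only [mul_one, mul_eq_left] at h0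
      rw [h0, inv_one]
    · rfl
    · contradiction
  have hr : normalizer ω g 1 = (ω g 1 1)⁻¹ := by simp [normalizer]
  simp only [coboundary, mul_one, one_mul, hl, hr] at h1 ⊢
  apply Additive.ofMul.injective
  replace h1 := congrArg Additive.ofMul h1
  simp only [ofMul_mul, ofMul_inv, ofMul_one] at h1 ⊢
  grind

/-- The `2`-cochain, obtained by averaging, whose coboundary agrees with the `3`-cocycle `ω` up to
roots of unity. -/
def rootCochain [Fintype G] (ω : G → G → G → Circle) (g h : G) : Circle :=
  circleRoot (Fintype.card G) (∏ k, ω g h k)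

theorem rootCochain_one_left [Fintype G] {ω : G → G → G → Circle} (hω : IsNormalized ω) (g : G) :
    rootCochain ω 1 g = 1 := by
  simp [rootCochain, (hω _ _).1, circleRoot_one]

theorem rootCochain_one_right [Fintype G] {ω : G → G → G → Circle} (hω : IsNormalized ω) (g : G) :
    rootCochain ω g 1 = 1 := by
  simp [rootCochain, (hω _ _).2.1, circleRoot_one]

/-- In the product over `l` of the cocycle identity at `(g,h,k,l)`, the substitution `kl ↦ l` turns
every factor except `ω(g,h,k)` into a value of `A(g,h) = ∏ₗ ω(g,h,l)`, so that `ω ^ |G| = dA`. -/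
theorem pow_card_eq [Fintype G] {ω : G → G → G → Circle} (hω : IsThreeCocycle ω) (g h k : G) :
    (ω g h k * (coboundary (rootCochain ω) g h k)⁻¹) ^ Fintype.card G = 1 := by
  have hprod := Finset.prod_congr (s₁ := Finset.univ) rfl fun l _ => hω g h k l
  simp only [Finset.prod_mul_distrib, Finset.prod_const, Finset.card_univ] at hprod
  rw [Fintype.prod_equiv (Equiv.mulLeft k) (fun l => ω g h (k * l)) (fun l => ω g h l)
    (fun _ => rfl)] at hprod
  simp only [coboundary, mul_pow, inv_pow, rootCochain, circleRoot_pow Fintype.card_ne_zero]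
  apply Additive.ofMul.injective
  replace hprod := congrArg Additive.ofMul hprod
  simp only [ofMul_mul, ofMul_inv, ofMul_one] at hprod ⊢
  grind

end Normalization

/-! ### A finite extension on which a cocycle of finite order becomes a coboundary. -/

section TwistedExtension

variable {G : Type u} [Group G] {M : Type} [CommGroup M]

/-- The conditions under which `TwistedExtension w` is a group: `w` is a normalised `3`-cocycle. -/
structure IsNormalizedCocycle (w : G → G → G → M) : Prop where
  cocycle : ∀ g h k l, w h k l * w g (h * k) l * w g h k = w (g * h) k l * w g h (k * l)
  one_left : ∀ g h, w 1 g h = 1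
  one_mid : ∀ g h, w g 1 h = 1
  one_right : ∀ g h, w g h 1 = 1

/-- The extension of `G` by the functions `f : G → M` with `f 1 = 1` on which a given
normalised `M`-valued `3`-cocycle `w` becomes trivial. -/
@[ext]
structure TwistedExtension (w : G → G → G → M) where
  base : G
  fn : G → M
  fn_one : fn 1 = 1

/-- The functions `f : G → M` with `f 1 = 1`. -/
abbrev pointedMaps (G : Type u) [Group G] (M : Type) [CommGroup M] : Subgroup (G → M) :=
  (Pi.evalMonoidHom (fun _ : G => M) 1).ker

/-- The underlying set of `TwistedExtension w`. -/
def TwistedExtension.equivProd (w : G → G → G → M) :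
    TwistedExtension w ≃ G × pointedMaps G M where
  toFun x := (x.base, ⟨x.fn, x.fn_one⟩)
  invFun p := ⟨p.1, p.2.1, p.2.2⟩

theorem TwistedExtension.card_dvd [Fintype G] [Finite M] (w : G → G → G → M) :
    Nat.card (TwistedExtension w) ∣ Nat.card G * Nat.card M ^ Nat.card G := by
  rw [Nat.card_congr (TwistedExtension.equivProd w), Nat.card_prod]
  refine mul_dvd_mul_left _ ((Subgroup.card_subgroup_dvd_card _).trans ?_)
  rw [Nat.card_fun]

/-- The group structure of `TwistedExtension w`. -/
abbrev TwistedExtension.group {w : G → G → G → M} (hw : IsNormalizedCocycle w) :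
    Group (TwistedExtension w) :=
  -- `G` acts on pointed functions from the right by `(f · g)(l) = f(gl) f(g)⁻¹`, and `w(g,h,·)`
  -- twists the semidirect product. Associativity is then exactly the cocycle identity, and the
  -- twist makes the cochain `(x,y) ↦ x.fn y.base` have coboundary the pull-back of `w`.
  letI : Mul (TwistedExtension w) := ⟨fun x y => ⟨x.base * y.base,
    fun l => x.fn (y.base * l) * (x.fn y.base)⁻¹ * y.fn l * w x.base y.base l, by
      simp [y.fn_one, hw.one_right]⟩⟩
  letI : One (TwistedExtension w) := ⟨⟨1, fun _ => 1, rfl⟩⟩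
  letI : Inv (TwistedExtension w) := ⟨fun x => ⟨x.base⁻¹,
    fun l => (x.fn (x.base⁻¹ * l))⁻¹ * x.fn x.base⁻¹ * (w x.base x.base⁻¹ l)⁻¹ *
      w x.base x.base⁻¹ 1, by simp⟩⟩
  Group.ofRightAxioms
    (fun x y z => by
      refine TwistedExtension.ext (mul_assoc _ _ _) (funext fun l => ?_)
      change x.fn (y.base * (z.base * l)) * (x.fn y.base)⁻¹ * y.fn (z.base * l) *
          w x.base y.base (z.base * l) *
          (x.fn (y.base * z.base) * (x.fn y.base)⁻¹ * y.fn z.base * w x.base y.base z.base)⁻¹ *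
          z.fn l * w (x.base * y.base) z.base l =
        x.fn (y.base * z.base * l) * (x.fn (y.base * z.base))⁻¹ *
          (y.fn (z.base * l) * (y.fn z.base)⁻¹ * z.fn l * w y.base z.base l) *
          w x.base (y.base * z.base) l
      have h := hw.cocycle x.base y.base z.base l
      rw [mul_assoc y.base]
      apply Additive.ofMul.injective
      replace h := congrArg Additive.ofMul h
      simp only [ofMul_mul, ofMul_inv] at h ⊢
      grind)
    (fun x => by
      refine TwistedExtension.ext (mul_one _) (funext fun l => ?_)
      change x.fn (1 * l) * (x.fn 1)⁻¹ * 1 * w x.base 1 l = x.fn l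
      simp [x.fn_one, hw.one_mid])
    (fun x => by
      refine TwistedExtension.ext (mul_inv_cancel _) (funext fun l => ?_)
      change x.fn (x.base⁻¹ * l) * (x.fn x.base⁻¹)⁻¹ * ((x.fn (x.base⁻¹ * l))⁻¹ * x.fn x.base⁻¹ *
        (w x.base x.base⁻¹ l)⁻¹ * w x.base x.base⁻¹ 1) * w x.base x.base⁻¹ l = 1
      rw [hw.one_right]
      apply Additive.ofMul.injective
      simp only [ofMul_mul, ofMul_inv, ofMul_one]
      abel)

end TwistedExtension

theorem exists_modelData {G : Type u} [Group G] [Fintype G] (ω : G → G → G → Circle)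
    (hω : IsThreeCocycle ω) :
    ∃ D : ModelData G ω, IsNormalized ω → ∀ g h, D.η g h = 1 := by
  classical
  set ω' : G → G → G → Circle := fun g h k => ω g h k * coboundary (normalizer ω) g h k with hω'
  have hN : IsNormalized ω' := isNormalized_mul_normalizer hω
  have hC : IsThreeCocycle ω' := hω.mul (isThreeCocycle_coboundary _)
  set a := rootCochain ω' with ha
  set n := Fintype.card G with hn
  have : NeZero n := ⟨Fintype.card_ne_zero⟩
  have hpow : ∀ g h k, (ω' g h k * (coboundary a g h k)⁻¹) ^ n = 1 := pow_card_eq hC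
  let w : G → G → G → rootsOfUnity n Circle := fun g h k => rootsOfUnity.mkOfPowEq _ (hpow g h k)
  have hwv : ∀ g h k, ((w g h k : Circleˣ) : Circle) = ω' g h k * (coboundary a g h k)⁻¹ :=
    fun g h k => rootsOfUnity.coe_mkOfPowEq _
  have hcoe : Function.Injective fun z : rootsOfUnity n Circle => ((z : Circleˣ) : Circle) :=
    Units.val_injective.comp Subtype.val_injective
  have haN := IsNormalized.coboundary (rootCochain_one_left hN) (rootCochain_one_right hN)
  have hw : IsNormalizedCocycle w :=
    { cocycle := fun g h k l => hcoe (by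
        simpa only [Subgroup.coe_mul, Units.val_mul, hwv] using
          hC.mul (isThreeCocycle_coboundary a).inv g h k l)
      one_left := fun g h => hcoe (by simp [hwv, (hN g h).1, (haN g h).1, ha])
      one_mid := fun g h => hcoe (by simp [hwv, (hN g h).2.1, (haN g h).2.1, ha])
      one_right := fun g h => hcoe (by simp [hwv, (hN g h).2.2, (haN g h).2.2, ha]) }
  let := TwistedExtension.group hw
  have : Finite (TwistedExtension w) := Finite.of_equiv _ (TwistedExtension.equivProd w).symm
  let : Fintype (TwistedExtension w) := Fintype.ofFinite _
  refine ⟨{ Γ := TwistedExtension w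
            -- One factor `n` comes from `G`, and `n ^ n` from all functions `G → μ_n`, among which
            -- the pointed ones form a subgroup.
            card_dvd := ⟨n + 1, ?_⟩
            ρ := { toFun := TwistedExtension.base, map_one' := rfl, map_mul' := fun _ _ => rfl }
            sec := fun g => ⟨g, 1, rfl⟩
            ρ_sec := fun _ => rfl
            η := normalizer ω
            -- Evaluation contributes `w` to the coboundary and `a` contributes `da`; together they
            -- give `ω'`. On `K` both factors are `1`, by pointedness and normalisation.
            c := fun x y => ((x.fn y.base : Circleˣ) : Circle) * a x.base y.base
            c_one_left := fun x => ?_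
            c_one_right := fun x => ?_
            c_ker := fun k l hk hl => ?_
            coboundary_c := fun x y z => ?_ }, normalizer_eq_one⟩
  · have h := TwistedExtension.card_dvd w
    rwa [HasEnoughRootsOfUnity.natCard_rootsOfUnity, Nat.card_eq_fintype_card,
      Nat.card_eq_fintype_card, ← hn, ← pow_succ'] at h
  · change ((1 : Circleˣ) : Circle) * a 1 x.base = 1
    rw [ha, rootCochain_one_left hN]; simp
  · change ((x.fn 1 : Circleˣ) : Circle) * a x.base 1 = 1
    rw [ha, rootCochain_one_right hN, x.fn_one]; simp
  · replace hl : l.base = 1 := hl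
    rw [hl, ha, rootCochain_one_right hN, k.fn_one]; simp
  · have h := hwv x.base y.base z.base
    change ((x.fn y.base : Circleˣ) : Circle) * a x.base y.base *
        ((((x.fn (y.base * z.base) * (x.fn y.base)⁻¹ * y.fn z.base * w x.base y.base z.base :
          rootsOfUnity n Circle) : Circleˣ) : Circle) * a (x.base * y.base) z.base) *
        (((x.fn (y.base * z.base) : Circleˣ) : Circle) * a x.base (y.base * z.base))⁻¹ *
        (((y.fn z.base : Circleˣ) : Circle) * a y.base z.base)⁻¹ = ω' x.base y.base z.base
    simp only [Subgroup.coe_mul, Units.val_mul, Subgroup.coe_inv, Units.val_inv_eq_inv_val]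
    simp only [coboundary] at h
    apply Additive.ofMul.injective
    replace h := congrArg Additive.ofMul h
    simp only [ofMul_mul, ofMul_inv] at h ⊢
    grind

/-! ### Structure of the crossed product by a finite group -/

section CrossedProduct

variable {K : Type u} [Group K] [Fintype K] [DecidableEq K]
variable {B : Type u} [CStarAlgebra B] [PartialOrder B] [StarOrderedRing B]
variable (π : K →* (B ≃⋆ₐ[ℂ] B))

namespace crossedProduct

theorem coe_of_apply (b : B) (s t : K) :
    (of π b : CStarMatrix K K B) s t = if s = t then π s⁻¹ b else 0 :=
  Matrix.diagonal_apply ..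

theorem coe_v_apply (k s t : K) :
    (v π k : CStarMatrix K K B) s t = if s = k * t then 1 else 0 := rfl

/-- The canonical inclusion of `B` in `B ⋊_π K`. -/
def ofHom : B →⋆ₐ[ℂ] crossedProduct π where
  toFun := of π
  map_one' := Subtype.ext <| CStarMatrix.ext fun s t => by
    rw [coe_of_apply, map_one]; rfl
  map_mul' a b := Subtype.ext <| CStarMatrix.ext fun s t => by
    rw [MulMemClass.coe_mul, CStarMatrix.mul_apply]
    simp only [coe_of_apply, mul_ite, mul_zero, Finset.sum_ite_eq', Finset.mem_univ, if_true,
      ite_mul, zero_mul]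
    split_ifs with h
    · subst h; exact map_mul _ _ _
    · rfl
  map_zero' := Subtype.ext <| CStarMatrix.ext fun s t => by
    rw [coe_of_apply, map_zero, ite_self]; rfl
  map_add' a b := Subtype.ext <| CStarMatrix.ext fun s t => by
    rw [AddMemClass.coe_add, CStarMatrix.add_apply]
    simp only [coe_of_apply]
    split_ifs <;> simp
  commutes' z := Subtype.ext <| CStarMatrix.ext fun s t => by
    rw [coe_of_apply, AlgHomClass.commutes]
    exact (CStarMatrix.algebraMap_apply ..).symm
  map_star' a := Subtype.ext <| CStarMatrix.ext fun s t => by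
    rw [StarMemClass.coe_star, CStarMatrix.star_apply]
    simp only [coe_of_apply]
    by_cases h : s = t
    · subst h; simp [map_star]
    · simp [h, Ne.symm h]

theorem ofHom_apply (b : B) : ofHom π b = of π b := rfl

theorem of_zero : of π 0 = 0 := map_zero (ofHom π)

theorem of_one : of π 1 = 1 := map_one (ofHom π)

theorem v_one : v π 1 = 1 := Subtype.ext <| CStarMatrix.ext fun s t => by
  rw [coe_v_apply, one_mul]; rfl

theorem v_mul (k l : K) : v π k * v π l = v π (k * l) :=
  Subtype.ext <| CStarMatrix.ext fun s t => by
    rw [MulMemClass.coe_mul, CStarMatrix.mul_apply]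
    simp [coe_v_apply, mul_assoc]

theorem star_v (k : K) : star (v π k) = v π k⁻¹ :=
  Subtype.ext <| CStarMatrix.ext fun s t => by
    rw [StarMemClass.coe_star, CStarMatrix.star_apply]
    simp only [coe_v_apply, eq_inv_mul_iff_mul_eq, eq_comm (a := t)]
    split_ifs <;> simp

theorem v_mul_of (k : K) (b : B) : v π k * of π b = of π (π k b) * v π k :=
  Subtype.ext <| CStarMatrix.ext fun s t => by
    rw [MulMemClass.coe_mul, CStarMatrix.mul_apply, MulMemClass.coe_mul, CStarMatrix.mul_apply]
    simp only [coe_v_apply, coe_of_apply, mul_ite, ite_mul, one_mul, zero_mul, mul_one, mul_zero,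
      Finset.sum_ite_eq', Finset.mem_univ, if_true]
    by_cases h : s = k * t
    · subst h
      simp [← StarAlgEquiv.mul_apply, ← map_mul]
    · have h' : k⁻¹ * s ≠ t := fun h' => h (by rw [← h', mul_inv_cancel_left])
      simp [h]

/-- The element `∑_k a_k v_k`. -/
def sum (a : K → B) : crossedProduct π := ∑ k, of π (a k) * v π k

theorem coe_of_mul_v_apply (b : B) (k s t : K) :
    ((of π b * v π k : crossedProduct π) : CStarMatrix K K B) s t =
      if s = k * t then π s⁻¹ b else 0 := by
  rw [MulMemClass.coe_mul, CStarMatrix.mul_apply]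
  simp [coe_of_apply, coe_v_apply]

theorem coe_sum_apply (a : K → B) (s t : K) :
    (sum π a : CStarMatrix K K B) s t = π s⁻¹ (a (s * t⁻¹)) := by
  have h : (sum π a : CStarMatrix K K B) s t =
      ∑ k, ((of π (a k) * v π k : crossedProduct π) : CStarMatrix K K B) s t := by
    rw [sum, AddSubmonoidClass.coe_finsetSum]
    exact Matrix.sum_apply ..
  rw [h, Finset.sum_eq_single (s * t⁻¹)]
  · rw [coe_of_mul_v_apply, if_pos (by simp)]
  · intro k _ hk
    rw [coe_of_mul_v_apply, if_neg (fun h => hk (by rw [h, mul_inv_cancel_right]))]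
  · simp

theorem sum_injective : Function.Injective (sum π) := by
  intro a b h
  funext k
  have := congrArg (fun x : crossedProduct π => (x : CStarMatrix K K B) 1 k⁻¹) h
  simpa [coe_sum_apply] using this

theorem sum_add (a b : K → B) : sum π (a + b) = sum π a + sum π b := by
  simp only [sum, Pi.add_apply, ← ofHom_apply, map_add, add_mul, Finset.sum_add_distrib]

theorem sum_smul (z : ℂ) (a : K → B) : sum π (z • a) = z • sum π a := by
  simp only [sum, Pi.smul_apply, ← ofHom_apply, map_smul, smul_mul_assoc, Finset.smul_sum]

theorem sum_single (b : B) (k : K) : sum π (Pi.single k b) = of π b * v π k := by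
  rw [sum, Finset.sum_eq_single k]
  · simp
  · intro l _ hl
    rw [Pi.single_eq_of_ne hl, of_zero, zero_mul]
  · simp

theorem of_mul_v_mem_range (b : B) (k : K) : of π b * v π k ∈ Set.range (sum π) :=
  ⟨Pi.single k b, sum_single π b k⟩

/-- The elements `∑_k a_k v_k`, as a subspace. -/
def sumRange : Submodule ℂ (crossedProduct π) where
  carrier := Set.range (sum π)
  add_mem' := by
    rintro _ _ ⟨a, rfl⟩ ⟨b, rfl⟩
    exact ⟨a + b, sum_add π a b⟩
  zero_mem' := ⟨0, by simp [sum, of_zero]⟩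
  smul_mem' := by
    rintro z _ ⟨a, rfl⟩
    exact ⟨z • a, sum_smul π z a⟩

theorem of_mul_v_mul_of_mul_v (a b : B) (k l : K) :
    of π a * v π k * (of π b * v π l) = of π (a * π k b) * v π (k * l) := by
  rw [mul_assoc, ← mul_assoc (v π k), v_mul_of, mul_assoc, v_mul, ← mul_assoc]
  congr 1
  exact ((ofHom π).map_mul _ _).symm

theorem star_of_mul_v (b : B) (k : K) :
    star (of π b * v π k) = of π (π k⁻¹ (star b)) * v π k⁻¹ := by
  rw [star_mul, star_v, ← v_mul_of]
  congr 1
  exact ((ofHom π).map_star' b).symm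

/-- The elements `∑_k a_k v_k`, as a `⋆`-subalgebra of the matrix algebra. -/
def sumSubalgebra : StarSubalgebra ℂ (CStarMatrix K K B) where
  carrier := (fun x : crossedProduct π => (x : CStarMatrix K K B)) '' (sumRange π)
  mul_mem' := by
    rintro _ _ ⟨_, ⟨a, rfl⟩, rfl⟩ ⟨_, ⟨b, rfl⟩, rfl⟩
    refine ⟨sum π a * sum π b, ?_, rfl⟩
    rw [sum, sum, Finset.sum_mul_sum]
    refine Submodule.sum_mem _ fun k _ => Submodule.sum_mem _ fun l _ => ?_
    rw [of_mul_v_mul_of_mul_v]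
    exact of_mul_v_mem_range ..
  add_mem' := by
    rintro _ _ ⟨x, hx, rfl⟩ ⟨y, hy, rfl⟩
    exact ⟨x + y, (sumRange π).add_mem hx hy, rfl⟩
  algebraMap_mem' z := by
    refine ⟨of π (algebraMap ℂ B z) * v π 1, of_mul_v_mem_range .., ?_⟩
    rw [v_one, mul_one, ← ofHom_apply, AlgHomClass.commutes]
    rfl
  star_mem' := by
    rintro _ ⟨_, ⟨a, rfl⟩, rfl⟩
    refine ⟨star (sum π a), ?_, rfl⟩
    rw [sum, star_sum]
    refine Submodule.sum_mem _ fun k _ => ?_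
    rw [star_of_mul_v]
    exact of_mul_v_mem_range ..

/-- The first row of such a matrix determines the others. Written as equations between entries,
membership is visibly a closed condition, so that finite sums need no completion. -/
theorem coe_sumSubalgebra : (sumSubalgebra π : Set (CStarMatrix K K B)) =
    {m | ∀ s t, m s t = π s⁻¹ (m 1 (t * s⁻¹))} := by
  ext m
  constructor
  · rintro ⟨_, ⟨a, rfl⟩, rfl⟩ s t
    change (sum π a : CStarMatrix K K B) s t = π s⁻¹ ((sum π a : CStarMatrix K K B) 1 (t * s⁻¹))
    simp [coe_sum_apply]
  · intro h
    refine ⟨_, ⟨fun k => m 1 k⁻¹, rfl⟩, CStarMatrix.ext fun s t => ?_⟩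
    rw [h s t]
    change (sum π _ : CStarMatrix K K B) s t = _
    rw [coe_sum_apply, mul_inv_rev, inv_inv]

theorem isClosed_sumSubalgebra : IsClosed (sumSubalgebra π : Set (CStarMatrix K K B)) := by
  rw [coe_sumSubalgebra]
  simp only [Set.ofPred_forall]
  refine isClosed_iInter fun s => isClosed_iInter fun t => ?_
  have hc : ∀ i j : K, Continuous fun m : CStarMatrix K K B => m i j := fun i j =>
    continuous_id.matrix_elem i j
  exact isClosed_eq (hc s t) ((StarAlgEquiv.isometry (π s⁻¹)).continuous.comp (hc _ _))

/-- The sums already form a closed `⋆`-subalgebra containing the generators. -/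
theorem sum_surjective : Function.Surjective (sum π) := by
  intro x
  have hle : crossedProduct π ≤ sumSubalgebra π := by
    refine StarSubalgebra.topologicalClosure_minimal (StarAlgebra.adjoin_le ?_)
      (isClosed_sumSubalgebra π)
    rintro _ (⟨b, rfl⟩ | ⟨k, rfl⟩)
    · refine ⟨of π b * v π 1, of_mul_v_mem_range .., ?_⟩
      rw [v_one, mul_one]; rfl
    · refine ⟨of π 1 * v π k, of_mul_v_mem_range .., ?_⟩
      rw [of_one, one_mul]; rfl
  obtain ⟨_, ⟨a, rfl⟩, h⟩ := hle x.2
  exact ⟨a, Subtype.ext h⟩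

/-- The bijection between functions `a : K → B` and elements `∑_k a_k v_k`. -/
def sumEquiv : (K → B) ≃ₗ[ℂ] crossedProduct π :=
  LinearEquiv.ofBijective
    { toFun := sum π, map_add' := sum_add π, map_smul' := sum_smul π }
    ⟨sum_injective π, sum_surjective π⟩

theorem sumEquiv_apply (a : K → B) : sumEquiv π a = sum π a := rfl

theorem induction {p : crossedProduct π → Prop} (h : ∀ b k, p (of π b * v π k))
    (hadd : ∀ x y, p x → p y → p (x + y)) (x : crossedProduct π) : p x := by
  obtain ⟨a, rfl⟩ := sum_surjective π x
  refine Finset.sum_induction _ p hadd ?_ fun k _ => h _ _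
  simpa [of_zero] using h 0 1

variable {M : Type*} [Ring M] [StarRing M] [Algebra ℂ M]

/-- A covariant representation of `(B, K, π)` as a linear map on the crossed product. -/
def liftLinear (f : B →⋆ₐ[ℂ] M) (w : K →* unitary M) : crossedProduct π →ₗ[ℂ] M :=
  (∑ k, (LinearMap.mulRight ℂ (w k : M)).comp
    ((f : B →ₗ[ℂ] M).comp (LinearMap.proj k))).comp (sumEquiv π).symm.toLinearMap

theorem liftLinear_sum (f : B →⋆ₐ[ℂ] M) (w : K →* unitary M) (a : K → B) :
    liftLinear π f w (sum π a) = ∑ k, f (a k) * (w k : M) := by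
  rw [← sumEquiv_apply]
  simp [liftLinear]

theorem liftLinear_of_mul_v (f : B →⋆ₐ[ℂ] M) (w : K →* unitary M) (b : B) (k : K) :
    liftLinear π f w (of π b * v π k) = f b * (w k : M) := by
  rw [← sum_single, liftLinear_sum, Finset.sum_eq_single k]
  · simp
  · intro l _ hl
    rw [Pi.single_eq_of_ne hl, map_zero, zero_mul]
  · simp

/-- The universal property of the crossed product. -/
def lift (f : B →⋆ₐ[ℂ] M) (w : K →* unitary M)
    (hw : ∀ k b, (w k : M) * f b = f (π k b) * (w k : M)) : crossedProduct π →⋆ₐ[ℂ] M where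
  toFun := liftLinear π f w
  map_zero' := map_zero _
  map_add' := map_add _
  map_one' := by
    have h := liftLinear_of_mul_v π f w 1 1
    rwa [v_one, mul_one, of_one, map_one f, map_one w, one_mul] at h
  commutes' z := by
    have h := liftLinear_of_mul_v π f w (algebraMap ℂ B z) 1
    rw [v_one, mul_one, ← ofHom_apply, AlgHomClass.commutes (ofHom π), AlgHomClass.commutes f,
      map_one] at h
    exact h.trans (mul_one _)
  map_mul' x y := by
    induction x using induction π with
    | hadd x x' hx hx' => rw [add_mul, map_add, hx, hx', map_add, add_mul]
    | h b k =>
      induction y using induction π with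
      | hadd y y' hy hy' => rw [mul_add, map_add, hy, hy', map_add, mul_add]
      | h b' k' =>
        rw [of_mul_v_mul_of_mul_v]
        simp only [liftLinear_of_mul_v]
        rw [map_mul, map_mul, Submonoid.coe_mul, mul_assoc (f b) (w k : M), ← mul_assoc (w k : M),
          hw, mul_assoc (f b), mul_assoc (f _)]
  map_star' x := by
    induction x using induction π with
    | hadd x x' hx hx' => rw [star_add, map_add, hx, hx', map_add, star_add]
    | h b k =>
      rw [star_of_mul_v]
      simp only [liftLinear_of_mul_v]
      rw [← hw, star_mul, ← map_star, map_inv, ← Unitary.star_eq_inv, Unitary.coe_star]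

theorem lift_sum (f : B →⋆ₐ[ℂ] M) (w : K →* unitary M)
    (hw : ∀ k b, (w k : M) * f b = f (π k b) * (w k : M)) (a : K → B) :
    lift π f w hw (sum π a) = ∑ k, f (a k) * (w k : M) := liftLinear_sum ..

theorem lift_of (f : B →⋆ₐ[ℂ] M) (w : K →* unitary M)
    (hw : ∀ k b, (w k : M) * f b = f (π k b) * (w k : M)) (b : B) :
    lift π f w hw (of π b) = f b := by
  have h := liftLinear_of_mul_v π f w b 1
  rw [v_one, mul_one, map_one] at h
  exact h.trans (mul_one _)

theorem lift_v (f : B →⋆ₐ[ℂ] M) (w : K →* unitary M)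
    (hw : ∀ k b, (w k : M) * f b = f (π k b) * (w k : M)) (k : K) :
    lift π f w hw (v π k) = w k := by
  have h := liftLinear_of_mul_v π f w 1 k
  rw [of_one, one_mul, map_one, one_mul] at h
  exact h

end crossedProduct

end CrossedProduct

/-! ### Local equivalences of spaces of sequences -/

section LocalEquiv

/-- A map between spaces of sequences is local if every initial segment of the image is
determined by an initial segment of the argument, and every tail of the argument determines a tail
of the image. -/
structure IsLocalMap {X Y : Type*} (f : (ℕ → X) → (ℕ → Y)) : Prop where
  head : ∀ n, ∃ m, ∀ x y : ℕ → X, (∀ i < m, x i = y i) → ∀ i < n, f x i = f y i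
  tail : ∀ n, ∃ m, ∀ x y : ℕ → X, (∀ i, n ≤ i → x i = y i) → ∀ i, m ≤ i → f x i = f y i

theorem IsLocalMap.comp {X Y Z : Type*} {f : (ℕ → X) → (ℕ → Y)} {g : (ℕ → Y) → (ℕ → Z)}
    (hg : IsLocalMap g) (hf : IsLocalMap f) : IsLocalMap (g ∘ f) where
  head n := by
    obtain ⟨m, hm⟩ := hg.head n
    obtain ⟨l, hl⟩ := hf.head m
    exact ⟨l, fun x y h => hm _ _ (hl x y h)⟩
  tail n := by
    obtain ⟨m, hm⟩ := hf.tail n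
    obtain ⟨l, hl⟩ := hg.tail m
    exact ⟨l, fun x y h => hl _ _ (hm x y h)⟩

/-- The bounds force `s i` and `t i` to tend to infinity, which is what locality at the tail needs;
the factor `2` leaves room for the indices `i / 2` of an interleaving. -/
theorem isLocalMap_of_coordinates {X Y : Type*} {f : (ℕ → X) → (ℕ → Y)} (s t : ℕ → ℕ)
    (hs : ∀ i, i ≤ 2 * s i + 1) (ht : ∀ i, i ≤ 2 * t i + 1)
    (h : ∀ x y i, x (s i) = y (s i) → x (t i) = y (t i) → f x i = f y i) : IsLocalMap f where
  head n := by
    refine ⟨(∑ i ∈ Finset.range n, (s i + t i)) + 1, fun x y hxy i hi => ?_⟩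
    have hle : s i + t i ≤ ∑ i ∈ Finset.range n, (s i + t i) :=
      Finset.single_le_sum (f := fun i => s i + t i) (fun _ _ => Nat.zero_le _)
        (Finset.mem_range.2 hi)
    exact h x y i (hxy _ (by omega)) (hxy _ (by omega))
  tail n := by
    refine ⟨2 * n + 1, fun x y hxy i hi => ?_⟩
    have h1 := hs i
    have h2 := ht i
    exact h x y i (hxy _ (by omega)) (hxy _ (by omega))

/-- The spaces of sequences in `X` and in `Y` are related by a bijection that is local in both
directions. -/
def LocallyEquiv (X Y : Type u) : Prop :=
  ∃ e : (ℕ → X) ≃ (ℕ → Y), IsLocalMap e ∧ IsLocalMap e.symm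

namespace LocallyEquiv

theorem of_equiv {X Y : Type u} (e : X ≃ Y) : LocallyEquiv X Y :=
  ⟨Equiv.arrowCongr (Equiv.refl ℕ) e,
    isLocalMap_of_coordinates id id (fun i => by simp; omega) (fun i => by simp; omega)
      (fun x y i h _ => congrArg e h),
    isLocalMap_of_coordinates id id (fun i => by simp; omega) (fun i => by simp; omega)
      (fun x y i h _ => congrArg e.symm h)⟩

theorem of_card_eq {X Y : Type u} [Fintype X] [Fintype Y]
    (h : Fintype.card X = Fintype.card Y) : LocallyEquiv X Y :=
  of_equiv (Fintype.equivOfCardEq h)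

theorem symm {X Y : Type u} : LocallyEquiv X Y → LocallyEquiv Y X :=
  fun ⟨e, h, h'⟩ => ⟨e.symm, h', h⟩

theorem trans {X Y Z : Type u} : LocallyEquiv X Y → LocallyEquiv Y Z → LocallyEquiv X Z :=
  fun ⟨e, he, he'⟩ ⟨f, hf, hf'⟩ => ⟨e.trans f, hf.comp he, (he'.comp hf' :)⟩

/-- The sequences `x₀, y₀, x₁, y₁, …`. -/
def interleave (X : Type u) : (ℕ → X × X) ≃ (ℕ → X) where
  toFun w i := if i % 2 = 0 then (w (i / 2)).1 else (w (i / 2)).2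
  invFun z i := (z (2 * i), z (2 * i + 1))
  left_inv w := by
    funext i
    have h1 : (2 * i + 1) / 2 = i := by omega
    simp [Nat.add_mod, h1]
  right_inv z := by
    funext i
    rcases Nat.mod_two_eq_zero_or_one i with h | h
    · have h1 : 2 * (i / 2) = i := by omega
      simp [h, h1]
    · have h1 : 2 * (i / 2) + 1 = i := by omega
      simp [h, h1]

theorem prod_self (X : Type u) : LocallyEquiv (X × X) X :=
  ⟨interleave X,
    isLocalMap_of_coordinates (fun i => i / 2) (fun i => i / 2) (fun i => by omega)
      (fun i => by omega) (fun x y i h _ => by simp [interleave, h]),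
    isLocalMap_of_coordinates (fun i => 2 * i) (fun i => 2 * i + 1) (fun i => by omega)
      (fun i => by omega) (fun x y i h h' => by simp [interleave, h, h'])⟩

theorem isLocalMap_prod {X Y : Type u} (Z : Type u) {f : (ℕ → X) → (ℕ → Y)} (hf : IsLocalMap f) :
    IsLocalMap fun (w : ℕ → X × Z) i => (f (fun j => (w j).1) i, (w i).2) where
  head n := by
    obtain ⟨m, hm⟩ := hf.head n
    exact ⟨max m n, fun x y h i hi => Prod.ext
      (hm _ _ (fun j hj => congrArg Prod.fst (h j (lt_max_of_lt_left hj))) i hi)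
      (congrArg (fun p => p.2) (h i (lt_max_of_lt_right hi)) :)⟩
  tail n := by
    obtain ⟨m, hm⟩ := hf.tail n
    exact ⟨max m n, fun x y h i hi => Prod.ext
      (hm _ _ (fun j hj => congrArg Prod.fst (h j hj)) i (le_of_max_le_left hi))
      (congrArg (fun p => p.2) (h i (le_of_max_le_right hi)) :)⟩

theorem prod_right {X Y : Type u} (h : LocallyEquiv X Y) (Z : Type u) :
    LocallyEquiv (X × Z) (Y × Z) := by
  obtain ⟨e, h, h'⟩ := h
  exact ⟨{ toFun := fun w i => (e (fun j => (w j).1) i, (w i).2)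
           invFun := fun w i => (e.symm (fun j => (w j).1) i, (w i).2)
           left_inv := fun w => by simp
           right_inv := fun w => by simp }, isLocalMap_prod Z h, isLocalMap_prod Z h'⟩

theorem pow (X : Type u) (m : ℕ) : LocallyEquiv (Fin (m + 1) → X) X := by
  induction m with
  | zero => exact of_equiv (Equiv.funUnique (Fin 1) X)
  | succ m ih =>
    refine (of_equiv ((Fin.consEquiv fun _ => X).symm.trans (Equiv.prodComm _ _))).trans ?_
    exact (ih.prod_right X).trans (prod_self X)

/-- If `|X|` divides `|Y|` and `|Y|` divides a power of `|X|`, the spaces of sequences in `X` and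
in `Y` are locally equivalent. -/
theorem of_card_dvd (X Y : Type u) [Fintype X] [Fintype Y]
    (hXY : Fintype.card X ∣ Fintype.card Y) {m : ℕ}
    (hYX : Fintype.card Y ∣ Fintype.card X ^ (m + 1)) : LocallyEquiv Y X := by
  obtain ⟨k, hk⟩ := hXY
  obtain ⟨l, hl⟩ := hYX
  -- With `|Y| = k|X|`: `Y × X ≅ (X × X) × k ∼ X × k ≅ Y`.
  have h1 : LocallyEquiv (Y × X) Y :=
    (of_card_eq (Y := (X × X) × ULift.{u} (Fin k)) (by simp [hk]; ring)).trans
      (((prod_self X).prod_right _).trans (of_card_eq (by simp [hk])))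
  -- With `|X|^(m+1) = l|Y|`: `X × Y ∼ X^(m+1) × Y ≅ (Y × Y) × l ∼ Y × l ≅ X^(m+1) ∼ X`.
  have h2 : LocallyEquiv (Y × X) X :=
    (of_equiv (Equiv.prodComm Y X)).trans <| ((pow X m).prod_right Y).symm.trans <|
      (of_card_eq (Y := (Y × Y) × ULift.{u} (Fin l)) (by simp [hl]; ring)).trans <|
        ((prod_self Y).prod_right _).trans <|
          (of_card_eq (Y := Fin (m + 1) → X) (by simp [hl])).trans (pow X m)
  exact h1.symm.trans h2

end LocallyEquiv

end LocalEquiv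

/-! ### Local operators belong to the infinite tensor product -/

section Generated

variable {M N : Type u} [CStarAlgebra M] [CStarAlgebra N]

theorem map_mem_of_generators (f : M →⋆ₐ[ℂ] N) {s : Set M} {S : StarSubalgebra ℂ N}
    (hS : IsClosed (S : Set N)) (h : ∀ b ∈ s, f b ∈ S) {b : M} (hb : b ∈ generated s) :
    f b ∈ S := by
  have hle : generated s ≤ S.comap f :=
    StarSubalgebra.topologicalClosure_minimal (StarAlgebra.adjoin_le h)
      (hS.preimage (AddMonoidHomClass.continuous_of_bound f 1 fun b => by
        simpa using NonUnitalStarAlgHom.norm_apply_le f b))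
  exact hle hb

/-- An isomorphism of C⋆-algebras that matches two families of generators restricts to the
generated C⋆-algebras. -/
def generatedEquiv (f : M ≃⋆ₐ[ℂ] N) {s : Set M} {t : Set N} (h : ∀ b ∈ s, f b ∈ generated t)
    (h' : ∀ b ∈ t, f.symm b ∈ generated s) : generated s ≃⋆ₐ[ℂ] generated t where
  toFun b := ⟨f b.1, map_mem_of_generators (f : M →⋆ₐ[ℂ] N) (isClosed_generated t) h b.2⟩
  invFun b := ⟨f.symm b.1,
    map_mem_of_generators (f.symm : N →⋆ₐ[ℂ] M) (isClosed_generated s) h' b.2⟩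
  left_inv _ := Subtype.ext (f.symm_apply_apply _)
  right_inv _ := Subtype.ext (f.apply_symm_apply _)
  map_mul' a b := Subtype.ext (map_mul f a.1 b.1)
  map_add' a b := Subtype.ext (map_add f a.1 b.1)
  map_star' a := Subtype.ext (map_star f a.1)
  map_smul' z a := Subtype.ext (map_smul f z a.1)

end Generated

/-! ### Unitaries induced by bijections of sequence spaces. -/

section Reindex

variable {X Y : Type u}

theorem memlp_comp_equiv (e : (ℕ → X) ≃ (ℕ → Y)) (ξ : TensorSpace Y) :
    Memℓp (fun x => ξ (e x)) 2 := by
  have h := lp.memℓp ξ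
  have h2 : 0 < (2 : ENNReal).toReal := by simp
  rw [memℓp_gen_iff h2] at h ⊢
  exact (e.summable_iff (f := fun x => ‖ξ x‖ ^ (2 : ENNReal).toReal)).2 h

/-- Composition with a bijection of the spaces of sequences, as a unitary operator. -/
def reindexOp (e : (ℕ → X) ≃ (ℕ → Y)) : TensorSpace Y ≃ₗᵢ[ℂ] TensorSpace X where
  toFun ξ := ⟨fun x => ξ (e x), memlp_comp_equiv e ξ⟩
  invFun ξ := ⟨fun x => ξ (e.symm x), memlp_comp_equiv e.symm ξ⟩
  map_add' ξ η := by ext x; rfl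
  map_smul' z ξ := by ext x; rfl
  left_inv ξ := by
    ext x
    change ξ (e (e.symm x)) = ξ x
    simp
  right_inv ξ := by
    ext x
    change ξ (e.symm (e x)) = ξ x
    simp
  norm_map' ξ := by
    have h2 : 0 < (2 : ENNReal).toReal := by simp
    rw [lp.norm_eq_tsum_rpow h2, lp.norm_eq_tsum_rpow h2]
    congr 1
    exact e.tsum_eq (fun x => ‖ξ x‖ ^ (2 : ENNReal).toReal)

@[simp] theorem reindexOp_apply (e : (ℕ → X) ≃ (ℕ → Y)) (ξ : TensorSpace Y) (x : ℕ → X) :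
    reindexOp e ξ x = ξ (e x) := rfl

@[simp] theorem reindexOp_symm_apply (e : (ℕ → X) ≃ (ℕ → Y)) (ξ : TensorSpace X) (y : ℕ → Y) :
    (reindexOp e).symm ξ y = ξ (e.symm y) := rfl

end Reindex

/-! ### Matrix units of finitely many tensor factors. -/

section LocalOperators

variable {Γ : Type u} [Group Γ] [Fintype Γ]

theorem site_mem (i : ℕ) (T : Matrix Γ Γ ℂ) : site i T ∈ tensorAlgebra Γ :=
  subset_generated _ ⟨i, T, rfl⟩

open Classical in
/-- The matrix unit of the first `n` tensor factors with indices `u 0, …, u (n - 1)` and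
`v 0, …, v (n - 1)`. -/
def headUnit (u v : ℕ → Γ) : ℕ → (TensorSpace Γ →L[ℂ] TensorSpace Γ)
  | 0 => 1
  | n + 1 => headUnit u v n * site n (Matrix.single (u n) (v n) 1)

theorem headUnit_mem (u v : ℕ → Γ) (n : ℕ) : headUnit u v n ∈ tensorAlgebra Γ := by
  induction n with
  | zero => exact one_mem _
  | succ n ih => exact mul_mem ih (site_mem _ _)

open Classical in
theorem headUnit_apply (u v : ℕ → Γ) (n : ℕ) (ξ : TensorSpace Γ) (x : ℕ → Γ) :
    headUnit u v n ξ x =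
      if ∀ i < n, x i = u i then ξ (fun i => if i < n then v i else x i) else 0 := by
  induction n generalizing ξ with
  | zero => simp [headUnit]
  | succ n ih =>
    change headUnit u v n (site n (Matrix.single (u n) (v n) 1) ξ) x = _
    rw [ih, site_apply, Finset.sum_eq_single (v n)]
    · simp only [lt_irrefl, if_false, Matrix.single_apply, and_true, Nat.lt_succ_iff_lt_or_eq,
        or_imp, forall_and, forall_eq, ite_mul, one_mul, zero_mul, ← ite_and]
      refine if_congr (by rw [eq_comm (a := u n)]) (congrArg ξ (funext fun i => ?_)) rfl
      by_cases hi : i = n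
      · subst hi; simp
      · simp [hi]
    · intro γ _ hγ
      rw [Matrix.single_apply_of_col_ne _ _ hγ.symm, zero_mul]
    · simp

/-- An operator `ξ ↦ ∑_j a_j(x) ξ(F_j x)`, where `a_j` and `F_j` involve only an initial segment of
the coordinates, belongs to the infinite tensor product. -/
theorem mem_tensorAlgebra_of_local {J : Type*} [Fintype J]
    (S : TensorSpace Γ →L[ℂ] TensorSpace Γ) (a : J → (ℕ → Γ) → ℂ)
    (F : J → (ℕ → Γ) → (ℕ → Γ)) (hS : ∀ ξ x, S ξ x = ∑ j, a j x * ξ (F j x)) {m n : ℕ}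
    (hmn : m ≤ n) (ha : ∀ j x y, (∀ i < n, x i = y i) → a j x = a j y)
    (hF : ∀ j x y, (∀ i < n, x i = y i) → ∀ i < m, F j x i = F j y i)
    (hF' : ∀ j x i, m ≤ i → F j x i = x i) : S ∈ tensorAlgebra Γ := by
  classical
  let ext : (Fin n → Γ) → ℕ → Γ := fun u i => if h : i < n then u ⟨i, h⟩ else 1
  have hext : ∀ (x : ℕ → Γ), ∀ i < n, ext (fun i => x i) i = x i := fun x i hi => by
    simp [ext, hi]
  -- On the cylinder of sequences beginning with the word `u`, the `j`-th term is the scalar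
  -- `a_j(u)` times a matrix unit. The first `n` coordinates are read, and only the first `m ≤ n`
  -- may be changed.
  have hSeq : S = ∑ j, ∑ u : Fin n → Γ, a j (ext u) • headUnit (ext u) (F j (ext u)) n := by
    ext ξ x
    simp only [hS, sum_apply, lp.coeFn_sum, Finset.sum_apply]
    refine Finset.sum_congr rfl fun j _ => ?_
    rw [Finset.sum_eq_single (fun i : Fin n => x i)]
    · rw [smul_apply, lp.coeFn_smul, Pi.smul_apply, headUnit_apply,
        if_pos fun i hi => (hext x i hi).symm, smul_eq_mul, ha j _ x (hext x)]
      refine congrArg (a j x * ·) (congrArg ξ (funext fun i => ?_))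
      by_cases hi : i < m
      · rw [if_pos (hi.trans_le hmn), hF j _ x (hext x) i hi]
      · rw [hF' j x i (not_lt.1 hi)]
        split_ifs with hin
        · rw [hF' j _ i (not_lt.1 hi), hext x i hin]
        · rfl
    · intro u _ hu
      rw [smul_apply, lp.coeFn_smul, Pi.smul_apply, headUnit_apply, if_neg,
        smul_zero]
      intro h
      refine hu (funext fun i => ?_)
      rw [h i i.2]
      simp [ext]
    · simp
  rw [hSeq]
  exact sum_mem fun j _ => sum_mem fun u _ => SMulMemClass.smul_mem _ (headUnit_mem _ _ _)

end LocalOperators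

section LocallyEquivUHF

variable {Γ G : Type u} [Group Γ] [Fintype Γ] [Group G] [Fintype G]

/-- The conjugated operator changes one coordinate of `e x` and transports back. Only locality at
the head is asked of `e` itself, so that the lemma also covers the inverse of `shear`, where a
change of one coordinate propagates to all later ones. -/
theorem conj_reindexOp_site_mem (e : (ℕ → G) ≃ (ℕ → Γ))
    (he : ∀ n, ∃ m, ∀ x y, (∀ i < m, x i = y i) → ∀ i < n, e x i = e y i)
    (he' : IsLocalMap e.symm) (i : ℕ) (T : Matrix Γ Γ ℂ) :
    (reindexOp e).conjStarAlgEquiv (site i T) ∈ tensorAlgebra G := by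
  -- `k` coordinates of `x` determine `(e x) i`; a change at `i` is invisible from `m` on after
  -- `e.symm`; `l` coordinates determine the first `m` values of `e.symm`; and `r` coordinates of
  -- `x` determine the first `l` of `e x`.
  obtain ⟨k, hk⟩ := he (i + 1)
  obtain ⟨m, hm⟩ := he'.tail (i + 1)
  obtain ⟨l, hl⟩ := he'.head m
  obtain ⟨r, hr⟩ := he l
  refine mem_tensorAlgebra_of_local (m := m) (n := max m (max k r)) _
    (fun γ x => T (e x i) γ) (fun γ x => e.symm (Function.update (e x) i γ)) ?_
    (le_max_left _ _) ?_ ?_ ?_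
  · intro ξ x
    rw [LinearIsometryEquiv.conjStarAlgEquiv_apply_apply, reindexOp_apply, site_apply]
    simp
  · intro γ x y h
    rw [hk x y (fun j hj => h j (by omega)) i (Nat.lt_succ_self i)]
  · intro γ x y h
    refine hl _ _ fun j hj => ?_
    have hj' := hr x y (fun j' hj' => h j' (by omega)) j hj
    by_cases hji : j = i
    · subst hji; simp
    · simp [hji, hj']
  · intro γ x j hj
    have h := hm (Function.update (e x) i γ) (e x)
      (fun j' hj' => Function.update_of_ne (by omega) _ _) j hj
    rwa [e.symm_apply_apply] at h

theorem nonempty_equiv_of_locallyEquiv (h : LocallyEquiv Γ G) :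
    Nonempty (UHF Γ ≃⋆ₐ[ℂ] UHF G) := by
  obtain ⟨e, he, he'⟩ := h
  refine ⟨generatedEquiv ((reindexOp e.symm).conjStarAlgEquiv) ?_ ?_⟩
  · rintro _ ⟨i, T, rfl⟩
    exact conj_reindexOp_site_mem e.symm he'.head he i T
  · rintro _ ⟨i, T, rfl⟩
    exact conj_reindexOp_site_mem e he.head he' i T

end LocallyEquivUHF

/-! ### The crossed product by a subgroup of `Γ` is a UHF algebra -/

section TailSupport

variable {Γ : Type u}

theorem isSelfAdjoint_mulOp (a : (ℕ → Γ) → ℂ) (C : ℝ) (hC : 0 ≤ C) (ha : ∀ x, ‖a x‖ ≤ C)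
    (ha' : ∀ x, star (a x) = a x) : IsSelfAdjoint (mulOp a C hC ha) := by
  rw [ContinuousLinearMap.isSelfAdjoint_iff_isSymmetric]
  intro ξ η
  simp only [ContinuousLinearMap.coe_coe, lp.inner_eq_tsum, mulOp_apply]
  refine tsum_congr fun x => ?_
  have h := ha' x
  simp only [RCLike.star_def] at h
  simp only [RCLike.inner_apply, map_mul, h]
  ring

/-- Two sequences are tail equivalent if they agree from some index on. -/
def TailEq (x y : ℕ → Γ) : Prop := ∃ n, ∀ i, n ≤ i → x i = y i

theorem TailEq.symm {x y : ℕ → Γ} : TailEq x y → TailEq y x :=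
  fun ⟨n, h⟩ => ⟨n, fun i hi => (h i hi).symm⟩

theorem TailEq.trans {x y z : ℕ → Γ} : TailEq x y → TailEq y z → TailEq x z :=
  fun ⟨n, h⟩ ⟨m, k⟩ => ⟨max n m, fun i hi =>
    (h i (le_of_max_le_left hi)).trans (k i (le_of_max_le_right hi))⟩

theorem tailEq_update (x : ℕ → Γ) (i : ℕ) (γ : Γ) : TailEq (Function.update x i γ) x :=
  ⟨i + 1, fun _ hj => Function.update_of_ne (by omega) _ _⟩

open Classical in
/-- The projection onto the vectors supported in the tail equivalence class of `z`. -/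
def tailProj (z : ℕ → Γ) : TensorSpace Γ →L[ℂ] TensorSpace Γ :=
  mulOp (fun x => if TailEq x z then 1 else 0) 1 zero_le_one (fun x => by split_ifs <;> simp)

open Classical in
theorem tailProj_apply (z : ℕ → Γ) (ξ : TensorSpace Γ) (x : ℕ → Γ) :
    tailProj z ξ x = if TailEq x z then ξ x else 0 := by
  simp [tailProj]

theorem isSelfAdjoint_tailProj (z : ℕ → Γ) : IsSelfAdjoint (tailProj z) :=
  isSelfAdjoint_mulOp _ _ _ _ fun x => by split_ifs <;> simp

variable [Group Γ] [Fintype Γ]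

/-- An operator on one coordinate preserves tail classes, hence commutes with the projection; the
centraliser is closed. -/
theorem tailProj_mul_comm (z : ℕ → Γ) {a : TensorSpace Γ →L[ℂ] TensorSpace Γ}
    (ha : a ∈ tensorAlgebra Γ) : tailProj z * a = a * tailProj z := by
  have hle : tensorAlgebra Γ ≤ StarSubalgebra.centralizer ℂ {tailProj z} := by
    refine StarSubalgebra.topologicalClosure_minimal (StarAlgebra.adjoin_le ?_)
      (Set.isClosed_centralizer _)
    rintro _ ⟨i, T, rfl⟩
    have h : tailProj z * site i T = site i T * tailProj z := by
      ext ξ x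
      simp only [mul_apply_eq_comp, tailProj_apply, site_apply]
      have hx : ∀ γ, TailEq (Function.update x i γ) z ↔ TailEq x z := fun γ =>
        ⟨(tailEq_update x i γ).symm.trans, (tailEq_update x i γ).trans⟩
      by_cases h : TailEq x z
      · rw [if_pos h]
        exact Finset.sum_congr rfl fun γ _ => by rw [if_pos ((hx γ).2 h)]
      · rw [if_neg h]
        exact (Finset.sum_eq_zero fun γ _ => by
          rw [if_neg fun h' => h ((hx γ).1 h'), mul_zero]).symm
    refine StarSubalgebra.mem_centralizer_iff _ |>.2 ?_
    rintro _ rfl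
    rw [(isSelfAdjoint_tailProj z).star_eq]
    exact ⟨h, h⟩
  exact ((StarSubalgebra.mem_centralizer_iff _).1 (hle ha) _ rfl).1

open Classical in
/-- The image of a basis vector under an element of the infinite tensor product is supported in a
tail equivalence class. -/
theorem apply_single_eq_zero {a : TensorSpace Γ →L[ℂ] TensorSpace Γ}
    (ha : a ∈ tensorAlgebra Γ) {x z : ℕ → Γ} (hxz : ¬ TailEq x z) :
    a (lp.single 2 z 1) x = 0 := by
  have h1 : tailProj z (lp.single 2 z 1) = (lp.single 2 z 1 : TensorSpace Γ) := by
    ext y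
    rw [tailProj_apply]
    split_ifs with hy
    · rfl
    · rw [lp.single_apply_ne]
      rintro rfl
      exact hy ⟨0, fun _ _ => rfl⟩
  have h2 := congrArg (fun T : TensorSpace Γ →L[ℂ] TensorSpace Γ => T (lp.single 2 z 1) x)
    (tailProj_mul_comm z ha)
  simp only [mul_apply_eq_comp, h1, tailProj_apply, if_neg hxz] at h2
  exact h2.symm

end TailSupport

/-! ### Faithful representation on `ℓ²(Γ^ℕ)` and the sheared coordinates. -/

section RegularCrossedProduct

variable {Γ K : Type u} [Group Γ] [Group K]

/-- Left translation by `K` is free, so `s γ` may record the position of `γ` relative to a chosen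
representative of its coset `Kγ`. -/
theorem exists_equivariant_map (ι : K →* Γ) (hι : Function.Injective ι) :
    ∃ s : Γ → K, ∀ k γ, s (ι k * γ) = k * s γ := by
  let r : Γ → Γ := fun γ => (Quotient.mk (QuotientGroup.rightRel ι.range) γ).out
  have hr : ∀ γ, ∃ k, ι k = γ * (r γ)⁻¹ := fun γ =>
    QuotientGroup.rightRel_apply.1 (Quotient.mk_out (s := QuotientGroup.rightRel ι.range) γ)
  choose s hs using hr
  refine ⟨s, fun k γ => hι ?_⟩
  have h : r (ι k * γ) = r γ := by
    refine congrArg Quotient.out (Quotient.sound ?_)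
    refine QuotientGroup.rightRel_apply.2 ⟨k⁻¹, ?_⟩
    simp
  rw [hs, h, map_mul, hs, mul_assoc]

/-- The inverse of the change of coordinates `shear`. -/
def unshearFun (ι : K →* Γ) (s : Γ → K) (y : ℕ → Γ) : ℕ → Γ
  | 0 => y 0
  | i + 1 => ι (s (unshearFun ι s y i)) * y (i + 1)

/-- The change of coordinates `x ↦ y` with `y₀ = x₀` and `y_{i+1} = s(x_i)⁻¹ x_{i+1}`, which turns
the diagonal left translations by `K` into left translations of the first coordinate. -/
def shear (ι : K →* Γ) (s : Γ → K) : (ℕ → Γ) ≃ (ℕ → Γ) where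
  toFun x
    | 0 => x 0
    | i + 1 => (ι (s (x i)))⁻¹ * x (i + 1)
  invFun := unshearFun ι s
  left_inv x := by
    funext i
    induction i with
    | zero => rfl
    | succ i ih => simp [unshearFun, ih]
  right_inv y := by
    funext i
    cases i <;> simp [unshearFun]

variable (ι : K →* Γ) (s : Γ → K)

theorem shear_succ (x : ℕ → Γ) (i : ℕ) :
    shear ι s x (i + 1) = (ι (s (x i)))⁻¹ * x (i + 1) := rfl

theorem shear_symm_succ (y : ℕ → Γ) (i : ℕ) :
    (shear ι s).symm y (i + 1) = ι (s ((shear ι s).symm y i)) * y (i + 1) := rfl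

theorem shear_head {x y : ℕ → Γ} {n : ℕ} (h : ∀ i < n, x i = y i) :
    ∀ i < n, shear ι s x i = shear ι s y i := by
  intro i hi
  cases i with
  | zero => exact h 0 hi
  | succ i => rw [shear_succ, shear_succ, h _ hi, h i (by omega)]

theorem shear_symm_head {x y : ℕ → Γ} {n : ℕ} (h : ∀ i < n, x i = y i) :
    ∀ i < n, (shear ι s).symm x i = (shear ι s).symm y i := by
  intro i hi
  induction i with
  | zero => exact h 0 hi
  | succ i ih => rw [shear_symm_succ, shear_symm_succ, h _ hi, ih (by omega)]

theorem isLocalMap_shear : IsLocalMap (shear ι s) :=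
  isLocalMap_of_coordinates (fun i => i - 1) id (fun i => by omega) (fun i => by simp; omega)
    fun x y i h h' => by
      cases i with
      | zero => exact h'
      | succ i =>
        simp only [Nat.add_sub_cancel, id] at h h'
        rw [shear_succ, shear_succ, h, h']

variable {s}

/-- Beyond the first coordinate the factor `k` cancels, since `s(k x_i)⁻¹ k x_{i+1} = s(x_i)⁻¹
x_{i+1}`. -/
theorem shear_diag (hs : ∀ k γ, s (ι k * γ) = k * s γ) (k : K) (x : ℕ → Γ) :
    shear ι s (fun i => ι k * x i) = Function.update (shear ι s x) 0 (ι k * x 0) := by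
  funext i
  cases i with
  | zero => rfl
  | succ i => simp [shear_succ, hs, mul_assoc]

/-- If the sheared sequences agree beyond `i`, the sequences differ there by a translation. -/
theorem eq_translate_of_shear_eq (hs : ∀ k γ, s (ι k * γ) = k * s γ) {x y : ℕ → Γ} {i : ℕ}
    (h : ∀ j, i < j → shear ι s y j = shear ι s x j) (j : ℕ) (hj : i < j) :
    y j = ι (s (y i) * (s (x i))⁻¹) * x j := by
  -- Equivariance of `s` keeps the ratio `s(y_j) s(x_j)⁻¹` constant from `i` on, so a single element
  -- of `K` translates the whole tail.
  have key : ∀ j, i ≤ j → s (y j) * (s (x j))⁻¹ = s (y i) * (s (x i))⁻¹ ∧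
      y (j + 1) = ι (s (y j) * (s (x j))⁻¹) * x (j + 1) := by
    intro j hj
    have step : ∀ j, i ≤ j → y (j + 1) = ι (s (y j) * (s (x j))⁻¹) * x (j + 1) := fun j hj => by
      have h1 := h (j + 1) (Nat.lt_succ_of_le hj)
      rw [shear_succ, shear_succ, inv_mul_eq_iff_eq_mul] at h1
      rw [h1, map_mul, map_inv, mul_assoc]
    refine ⟨?_, step j hj⟩
    induction j, hj using Nat.le_induction with
    | base => rfl
    | succ j hj ih => rw [step j hj, hs, mul_inv_cancel_right, ih]
  obtain ⟨j, rfl⟩ : ∃ j', j = j' + 1 := ⟨j - 1, by omega⟩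
  obtain ⟨h1, h2⟩ := key j (Nat.lt_succ_iff.1 hj)
  rw [h2, h1]

theorem diagShift_single [DecidableEq (ℕ → Γ)] (γ : Γ) (z : ℕ → Γ) :
    (diagShift γ : TensorSpace Γ →L[ℂ] TensorSpace Γ) (lp.single 2 z 1) =
      lp.single 2 (fun i => γ * z i) 1 := by
  ext x
  rw [diagShift_apply, lp.single_apply, lp.single_apply]
  simp only [Pi.single_apply]
  refine if_congr ⟨?_, ?_⟩ rfl rfl
  · rintro rfl; simp
  · rintro rfl; simp

variable [Fintype Γ]

/-- The defining representation of the UHF algebra. -/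
def UHF.toOp : UHF Γ →⋆ₐ[ℂ] (TensorSpace Γ →L[ℂ] TensorSpace Γ) :=
  (tensorAlgebra Γ).subtype

theorem UHF.toOp_mem (b : UHF Γ) : b.toOp ∈ tensorAlgebra Γ := Subtype.prop b

theorem UHF.toOp_injective : Function.Injective (UHF.toOp (Γ := Γ)) := Subtype.val_injective

/-- An operator in the infinite tensor product as an element of the UHF algebra. -/
def UHF.mk (b : TensorSpace Γ →L[ℂ] TensorSpace Γ) (hb : b ∈ tensorAlgebra Γ) : UHF Γ := ⟨b, hb⟩

theorem UHF.toOp_mk (b : TensorSpace Γ →L[ℂ] TensorSpace Γ) (hb : b ∈ tensorAlgebra Γ) :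
    (UHF.mk b hb).toOp = b := rfl

theorem UHF.toOp_tensorAction (γ : Γ) (b : UHF Γ) :
    (tensorAction γ b).toOp = (diagShift γ : TensorSpace Γ →L[ℂ] TensorSpace Γ) * b.toOp *
      star (diagShift γ : TensorSpace Γ →L[ℂ] TensorSpace Γ) := rfl

theorem diagShift_mul_toOp (γ : Γ) (b : UHF Γ) :
    (diagShift γ : TensorSpace Γ →L[ℂ] TensorSpace Γ) * b.toOp =
      (tensorAction γ b).toOp * diagShift γ := by
  rw [UHF.toOp_tensorAction, mul_assoc _ (star _), Unitary.coe_star_mul_self, mul_one]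

variable [Fintype K] [DecidableEq K]

/-- The representation of the crossed product on `ℓ²(Γ^ℕ)`. -/
def spatialRep : crossedProduct (tensorAction.comp ι : K →* (UHF Γ ≃⋆ₐ[ℂ] UHF Γ)) →⋆ₐ[ℂ]
    (TensorSpace Γ →L[ℂ] TensorSpace Γ) :=
  crossedProduct.lift _ UHF.toOp (diagShift.comp ι) fun k b => diagShift_mul_toOp (ι k) b

theorem spatialRep_of (b : UHF Γ) : spatialRep ι (crossedProduct.of _ b) = b.toOp :=
  crossedProduct.lift_of ..

theorem spatialRep_v (k : K) : spatialRep ι (crossedProduct.v _ k) =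
    (diagShift (ι k) : TensorSpace Γ →L[ℂ] TensorSpace Γ) :=
  crossedProduct.lift_v ..

theorem spatialRep_sum (a : K → UHF Γ) : spatialRep ι (crossedProduct.sum _ a) =
    ∑ k, (a k).toOp * (diagShift (ι k) : TensorSpace Γ →L[ℂ] TensorSpace Γ) :=
  crossedProduct.lift_sum ..

theorem spatialRep_injective (hι : Function.Injective ι) :
    Function.Injective (spatialRep ι) := by
  classical
  refine (injective_iff_map_eq_zero _).2 fun x hx => ?_
  obtain ⟨a, rfl⟩ := crossedProduct.sum_surjective _ x
  rw [spatialRep_sum] at hx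
  have hk : ∀ k (y x : ℕ → Γ),
      (a k).toOp (lp.single 2 (fun i => ι k * y i) 1) x = 0 := by
    intro k y x
    by_cases hxk : TailEq x (fun i => ι k * y i)
    · have h := congrArg (fun T : TensorSpace Γ →L[ℂ] TensorSpace Γ => T (lp.single 2 y 1) x) hx
      simp only [sum_apply, lp.coeFn_sum, Finset.sum_apply, mul_apply_eq_comp,
        diagShift_single] at h
      rw [Finset.sum_eq_single k] at h
      · exact h
      -- The index `x` is tail equivalent to `k y`, so it cannot be tail equivalent to `l y` for `l
      -- ≠ k`: the tails would force `l = k` by cancellation.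
      · intro l _ hl
        refine apply_single_eq_zero (UHF.toOp_mem _) fun hxl => hl (hι ?_)
        obtain ⟨n, hn⟩ := hxl.symm.trans hxk
        exact mul_right_cancel (hn n le_rfl)
      · simp
    · exact apply_single_eq_zero (UHF.toOp_mem _) hxk
  have ha : a = 0 := by
    funext k
    refine UHF.toOp_injective ?_
    rw [Pi.zero_apply, map_zero]
    refine lp.ext_continuousLinearMap (by simp) fun z => ?_
    ext x
    have h := hk k (fun i => (ι k)⁻¹ * z i) x
    simpa using h
  rw [ha]
  exact (crossedProduct.sumEquiv _).map_zero

/-- The representation of the crossed product in the sheared coordinates. -/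
def shearedRep (s : Γ → K) :
    crossedProduct (tensorAction.comp ι : K →* (UHF Γ ≃⋆ₐ[ℂ] UHF Γ)) →⋆ₐ[ℂ]
      (TensorSpace Γ →L[ℂ] TensorSpace Γ) :=
  ((reindexOp (shear ι s).symm).conjStarAlgEquiv : _ →⋆ₐ[ℂ] _).comp (spatialRep ι)

theorem shearedRep_mem (hs : ∀ k γ, s (ι k * γ) = k * s γ)
    (x : crossedProduct (tensorAction.comp ι : K →* (UHF Γ ≃⋆ₐ[ℂ] UHF Γ))) :
    shearedRep ι s x ∈ tensorAlgebra Γ := by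
  induction x using crossedProduct.induction with
  | hadd x y hx hy => rw [map_add]; exact add_mem hx hy
  | h b k =>
    rw [map_mul]
    refine mul_mem ?_ ?_
    · change (reindexOp (shear ι s).symm).conjStarAlgEquiv (spatialRep ι _) ∈ _
      rw [spatialRep_of]
      refine map_mem_of_generators
        ((reindexOp (shear ι s).symm).conjStarAlgEquiv :
          (TensorSpace Γ →L[ℂ] TensorSpace Γ) →⋆ₐ[ℂ] (TensorSpace Γ →L[ℂ] TensorSpace Γ))
        (isClosed_generated _) ?_ b.toOp_mem
      rintro _ ⟨i, T, rfl⟩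
      exact conj_reindexOp_site_mem _ (fun n => ⟨n, fun x y h => shear_symm_head ι s h⟩)
        (isLocalMap_shear ι s) i T
    · change (reindexOp (shear ι s).symm).conjStarAlgEquiv (spatialRep ι _) ∈ _
      rw [spatialRep_v]
      -- In sheared coordinates the diagonal translation touches coordinate `0` only, by
      -- `shear_diag`.
      refine mem_tensorAlgebra_of_local (m := 1) (n := 1) (J := Unit) _ (fun _ _ => 1)
        (fun _ x => Function.update x 0 (ι k⁻¹ * x 0)) ?_ le_rfl (fun _ _ _ _ => rfl) ?_ ?_
      · intro ξ x
        rw [LinearIsometryEquiv.conjStarAlgEquiv_apply_apply, reindexOp_apply]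
        change ((reindexOp (shear ι s).symm).symm ξ) (fun i => (ι k)⁻¹ * (shear ι s).symm x i) = _
        have h := shear_diag ι hs k⁻¹ ((shear ι s).symm x)
        rw [Equiv.apply_symm_apply, map_inv] at h
        simp [h]
        rfl
      · intro _ x y h i hi
        obtain rfl : i = 0 := by omega
        simp [h 0 one_pos]
      · intro _ x i hi
        exact Function.update_of_ne (by omega) _ _

-- Changing the `i`-th sheared coordinate translates all later original coordinates by some element
-- of `K`. Cutting with the projections onto `x_i = δ` before and after the change fixes that
-- element, and multiplying by the corresponding `v_k` undoes the translation. What remains is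
-- local, hence lies in `B`.
open Classical in
theorem site_mem_range_shearedRep (hs : ∀ k γ, s (ι k * γ) = k * s γ) (i : ℕ)
    (T : Matrix Γ Γ ℂ) : site i T ∈ (shearedRep ι s).range := by
  set Φ := (reindexOp (shear ι s)).conjStarAlgEquiv with hΦ
  have hmem : Φ (site i T) ∈ (spatialRep ι).range := by
    let P : Γ → (TensorSpace Γ →L[ℂ] TensorSpace Γ) := fun δ => site i (Matrix.single δ δ 1)
    have hP : ∀ δ ξ x, P δ ξ x = if x i = δ then ξ x else 0 := fun δ ξ x => by
      rw [site_apply]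
      by_cases hx : x i = δ
      · subst hx
        rw [Finset.sum_eq_single (x i)]
        · simp
        · intro γ _ hγ
          simp [hγ.symm]
        · simp
      · simp [hx, Ne.symm hx]
    have hsum : ∑ δ, P δ = 1 := by
      ext ξ x
      simp only [sum_apply, lp.coeFn_sum, Finset.sum_apply, hP]
      simp
    have hdecomp : Φ (site i T) = ∑ δ, ∑ δ', P δ * Φ (site i T) * P δ' := by
      simp_rw [← Finset.mul_sum, ← Finset.sum_mul, hsum, one_mul, mul_one]
    rw [hdecomp]
    refine sum_mem fun δ _ => sum_mem fun δ' _ => ?_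
    -- By `eq_translate_of_shear_eq`, when the `i`-th coordinate passes from `δ` to `δ'` the tail is
    -- translated by `k⁻¹`.
    set k := s δ * (s δ')⁻¹ with hk
    have hloc : P δ * Φ (site i T) * P δ' *
        (diagShift (ι k⁻¹) : TensorSpace Γ →L[ℂ] TensorSpace Γ) ∈ tensorAlgebra Γ := by
      let F : Γ → (ℕ → Γ) → (ℕ → Γ) := fun γ x =>
        (shear ι s).symm (Function.update (shear ι s x) i γ)
      have hF : ∀ γ (x y : ℕ → Γ), (∀ j < i + 1, x j = y j) → ∀ j < i + 1, F γ x j = F γ y j := by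
        intro γ x y h
        refine shear_symm_head ι s fun j hj => ?_
        by_cases hji : j = i
        · subst hji; simp
        · simp [hji, shear_head ι s h j hj]
      refine mem_tensorAlgebra_of_local (m := i + 1) (n := i + 1) _
        (fun γ x => if x i = δ ∧ F γ x i = δ' then T (shear ι s x i) γ else 0)
        (fun γ x => if x i = δ ∧ F γ x i = δ' then fun j => ι k * F γ x j else x) ?_ le_rfl ?_ ?_ ?_
      · intro ξ x
        have hd : ∀ x, (diagShift (ι k⁻¹) : TensorSpace Γ →L[ℂ] TensorSpace Γ) ξ x =
            ξ (fun j => ι k * x j) := fun x => by simp [diagShift_apply, ← map_inv]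
        simp only [mul_apply_eq_comp, hP, hΦ, LinearIsometryEquiv.conjStarAlgEquiv_apply_apply,
          reindexOp_apply, site_apply, reindexOp_symm_apply, hd]
        by_cases hx : x i = δ
        · simp only [hx, if_true, true_and]
          refine Finset.sum_congr rfl fun γ _ => ?_
          by_cases hγ : F γ x i = δ'
          · have hγ' : (shear ι s).symm (Function.update (shear ι s x) i γ) i = δ' := hγ
            simp only [hγ, hγ', if_true]
            rfl
          · have hγ' : ¬ (shear ι s).symm (Function.update (shear ι s x) i γ) i = δ' := hγ
            simp [hγ, hγ']
        · simp [hx]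
      · intro γ x y h
        simp only [h i (Nat.lt_succ_self i), hF γ x y h i (Nat.lt_succ_self i),
          shear_head ι s h i (Nat.lt_succ_self i)]
      · intro γ x y h j hj
        simp only [h i (Nat.lt_succ_self i), hF γ x y h i (Nat.lt_succ_self i)]
        split_ifs
        · simp only [hF γ x y h j hj]
        · exact h j hj
      · intro γ x j hj
        split_ifs with hc
        · have h := eq_translate_of_shear_eq ι hs (x := x) (y := F γ x) (i := i) (fun j hj => by
            simp only [F, Equiv.apply_symm_apply]
            exact Function.update_of_ne hj.ne' _ _) j hj
          simp only []
          rw [h, hc.1, hc.2, ← mul_assoc, ← map_mul, hk]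
          simp
        · rfl
    refine ⟨crossedProduct.of _ (UHF.mk _ hloc) * crossedProduct.v _ k, ?_⟩
    change spatialRep ι _ = _
    rw [map_mul, spatialRep_of, spatialRep_v, UHF.toOp_mk]
    rw [mul_assoc _ (diagShift (ι k⁻¹) : TensorSpace Γ →L[ℂ] TensorSpace Γ), ← Submonoid.coe_mul,
      ← map_mul, ← map_mul, inv_mul_cancel, map_one, map_one, Submonoid.coe_one, mul_one]
  obtain ⟨x, hx⟩ := hmem
  exact ⟨x, (congrArg Φ.symm hx).trans (Φ.symm_apply_apply _)⟩

/-- An injective `⋆`-homomorphism is isometric, so the range of the sheared representation is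
closed; it therefore suffices that it contains the generators `r_i(T)`. -/
theorem nonempty_crossedProduct_equiv (hι : Function.Injective ι) :
    Nonempty (crossedProduct (tensorAction.comp ι : K →* (UHF Γ ≃⋆ₐ[ℂ] UHF Γ)) ≃⋆ₐ[ℂ] UHF Γ) := by
  obtain ⟨s, hs⟩ := exists_equivariant_map ι hι
  set A := crossedProduct (tensorAction.comp ι : K →* (UHF Γ ≃⋆ₐ[ℂ] UHF Γ))
  have hA : IsClosed (A : Set (CStarMatrix K K (UHF Γ))) := isClosed_generated _
  have hinj : Function.Injective (shearedRep ι s) :=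
    (EquivLike.injective (reindexOp (shear ι s).symm).conjStarAlgEquiv).comp (spatialRep_injective ι hι)
  let _ : CStarAlgebra A := inferInstance
  have hclosed : IsClosed ((shearedRep ι s).range : Set (TensorSpace Γ →L[ℂ] TensorSpace Γ)) :=
    (NonUnitalStarAlgHom.isometry (shearedRep ι s) hinj).isClosedEmbedding.isClosed_range
  let f : A →⋆ₐ[ℂ] tensorAlgebra Γ := (shearedRep ι s).codRestrict _ (shearedRep_mem ι hs)
  refine ⟨StarAlgEquiv.ofBijective f ⟨fun x y h => hinj (congrArg Subtype.val h), fun b => ?_⟩⟩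
  have hle : tensorAlgebra Γ ≤ (shearedRep ι s).range := by
    refine StarSubalgebra.topologicalClosure_minimal (StarAlgebra.adjoin_le ?_) hclosed
    rintro _ ⟨i, T, rfl⟩
    exact site_mem_range_shearedRep ι hs i T
  obtain ⟨x, hx⟩ := hle b.2
  exact ⟨x, Subtype.ext hx⟩

end RegularCrossedProduct

theorem ModelData.nonempty_equiv {G : Type u} [Group G] [Fintype G] {ω : G → G → G → Circle}
    (D : ModelData G ω) : Nonempty (D.Alg ≃⋆ₐ[ℂ] UHF G) := by
  obtain ⟨e⟩ := nonempty_crossedProduct_equiv D.incl Subtype.val_injective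
  obtain ⟨m, hm⟩ := D.card_dvd
  have hsurj : Function.Surjective D.ρ := fun g => ⟨D.sec g, D.ρ_sec g⟩
  have hdvd : Fintype.card G ∣ Fintype.card D.Γ := by
    simpa only [Nat.card_eq_fintype_card] using Subgroup.card_dvd_of_surjective D.ρ hsurj
  obtain ⟨f⟩ := nonempty_equiv_of_locallyEquiv
    (LocallyEquiv.of_card_dvd G D.Γ hdvd (hm.trans (pow_dvd_pow _ (Nat.le_succ m))))
  exact ⟨e.trans f⟩

/-! ### The model action -/

section CircleMultiples

variable {K : Type u} [Group K] [Fintype K] [DecidableEq K]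
variable {B : Type u} [CStarAlgebra B] [PartialOrder B] [StarOrderedRing B]
variable (π : K →* (B ≃⋆ₐ[ℂ] B))

namespace crossedProduct

/-- The unitary `z v_k`, where `z` is a scalar of modulus one. -/
def phaseV (z : Circle) (k : K) : crossedProduct π := (z : ℂ) • v π k

theorem phaseV_mul (z w : Circle) (k l : K) :
    phaseV π z k * phaseV π w l = phaseV π (z * w) (k * l) := by
  rw [phaseV, phaseV, smul_mul_smul_comm, v_mul, ← Circle.coe_mul, phaseV]

theorem phaseV_one (z : Circle) : phaseV π z 1 = (z : ℂ) • (1 : crossedProduct π) := by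
  rw [phaseV, v_one]

theorem star_phaseV (z : Circle) (k : K) : star (phaseV π z k) = phaseV π z⁻¹ k⁻¹ := by
  rw [phaseV, star_smul, star_v, phaseV, Circle.coe_inv_eq_conj]
  rfl

theorem phaseV_mem_unitary (z : Circle) (k : K) : phaseV π z k ∈ unitary (crossedProduct π) := by
  rw [Unitary.mem_iff, star_phaseV, phaseV_mul, phaseV_mul]
  simp [phaseV_one]

theorem phaseV_mul_of (z : Circle) (k : K) (b : B) :
    phaseV π z k * of π b = of π (π k b) * phaseV π z k := by
  rw [phaseV, smul_mul_assoc, v_mul_of, mul_smul_comm]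

end crossedProduct

end CircleMultiples

namespace ModelData

variable {G : Type u} [Group G] [Fintype G] {ω : G → G → G → Circle} (D : ModelData G ω)

theorem coboundary_congr {x y z x' y' z' : D.Γ} (hx : D.ρ x = D.ρ x') (hy : D.ρ y = D.ρ y')
    (hz : D.ρ z = D.ρ z') : coboundary D.c x y z = coboundary D.c x' y' z' := by
  rw [D.coboundary_c, D.coboundary_c, hx, hy, hz]

/-- The `2`-cocycle identity for `c` holds as soon as one of the arguments lies in `K`. -/
theorem c_assoc {x y z : D.Γ} (h : D.ρ x = 1 ∨ D.ρ y = 1 ∨ D.ρ z = 1) :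
    D.c x y * D.c (x * y) z = D.c x (y * z) * D.c y z := by
  -- `dc` depends only on images in `G`, so the argument in `K` may be replaced by `1`, where
  -- normalisation applies.
  have h1 : coboundary D.c x y z = 1 := by
    rcases h with h | h | h
    · rw [D.coboundary_congr (h.trans (map_one D.ρ).symm) rfl rfl]
      simp [coboundary, D.c_one_left]
    · rw [D.coboundary_congr rfl (h.trans (map_one D.ρ).symm) rfl]
      simp [coboundary, D.c_one_left, D.c_one_right]
    · rw [D.coboundary_congr rfl rfl (h.trans (map_one D.ρ).symm)]
      simp [coboundary, D.c_one_right]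
  rw [coboundary, mul_inv_eq_one, mul_inv_eq_iff_eq_mul] at h1
  rw [h1, mul_comm]

/-- The scalar `c(x k x⁻¹, x) conj(c(x, k))`. -/
def χ (x k : D.Γ) : Circle := D.c (x * k * x⁻¹) x * (D.c x k)⁻¹

/-- This is what makes `v_k ↦ χ(ĝ,k) v_{ĝkĝ⁻¹}` a representation of `K`. -/
theorem χ_mul (x : D.Γ) {k l : D.Γ} (hk : D.ρ k = 1) (hl : D.ρ l = 1) :
    D.χ x (k * l) = D.χ x k * D.χ x l := by
  have hk' : D.ρ (x * k * x⁻¹) = 1 := by simp [hk]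
  have hl' : D.ρ (x * l * x⁻¹) = 1 := by simp [hl]
  have h1 := D.c_assoc (x := x) (y := k) (z := l) (Or.inr (Or.inl hk))
  have h2 := D.c_assoc (x := x * k * x⁻¹) (y := x * l * x⁻¹) (z := x) (Or.inl hk')
  have h3 := D.c_assoc (x := x * k * x⁻¹) (y := x) (z := l) (Or.inl hk')
  rw [D.c_ker k l hk hl] at h1
  rw [D.c_ker _ _ hk' hl'] at h2
  have e1 : x * k * x⁻¹ * (x * l * x⁻¹) = x * (k * l) * x⁻¹ := by group
  rw [e1, inv_mul_cancel_right] at h2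
  rw [inv_mul_cancel_right] at h3
  simp only [χ]
  apply Additive.ofMul.injective
  replace h1 := congrArg Additive.ofMul h1
  replace h2 := congrArg Additive.ofMul h2
  replace h3 := congrArg Additive.ofMul h3
  simp only [ofMul_mul, ofMul_inv, ofMul_one] at h1 h2 h3 ⊢
  grind

/-- Together with `χ_ker`, this matches the phases of `α_g α_h` with those of `α_{gh}`: the lifts
`ĝĥ` and `(gh)^` differ by an element of `K`, on which `χ` is trivial. -/
theorem χ_comp (x y : D.Γ) {k : D.Γ} (hk : D.ρ k = 1) :
    D.χ (x * y) k = D.χ y k * D.χ x (y * k * y⁻¹) := by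
  have hk' : D.ρ (y * k * y⁻¹) = 1 := by simp [hk]
  have hk'' : D.ρ (x * (y * k * y⁻¹) * x⁻¹) = 1 := by simp [hk]
  have h1 := D.c_assoc (x := x) (y := y) (z := k) (Or.inr (Or.inr hk))
  have h2 := D.c_assoc (x := x) (y := y * k * y⁻¹) (z := y) (Or.inr (Or.inl hk'))
  have h3 := D.c_assoc (x := x * (y * k * y⁻¹) * x⁻¹) (y := x) (z := y) (Or.inl hk'')
  have e1 : x * y * k * (x * y)⁻¹ = x * (y * k * y⁻¹) * x⁻¹ := by group
  rw [inv_mul_cancel_right] at h2 h3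
  simp only [χ, e1]
  apply Additive.ofMul.injective
  replace h1 := congrArg Additive.ofMul h1
  replace h2 := congrArg Additive.ofMul h2
  replace h3 := congrArg Additive.ofMul h3
  simp only [ofMul_mul, ofMul_inv] at h1 h2 h3 ⊢
  grind

theorem χ_ker {k l : D.Γ} (hk : D.ρ k = 1) (hl : D.ρ l = 1) : D.χ k l = 1 := by
  have hk' : D.ρ (k * l * k⁻¹) = 1 := by simp [hk, hl]
  rw [χ, D.c_ker _ _ hk' hk, D.c_ker _ _ hk hl, inv_one, mul_one]

/-- The scalar identity behind the computation of the anomaly. -/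
theorem defect_scalar {x y z p q r : D.Γ} (hp : D.ρ p = D.ρ x * D.ρ y)
    (hq : D.ρ q = D.ρ y * D.ρ z) (hr : D.ρ r = D.ρ x * D.ρ y * D.ρ z) :
    (D.c y z)⁻¹ * D.c (y * z * q⁻¹) q * D.χ x (y * z * q⁻¹) *
      ((D.c x q)⁻¹ * D.c (x * q * r⁻¹) r) * ((D.c p z)⁻¹ * D.c (p * z * r⁻¹) r)⁻¹ *
      ((D.c x y)⁻¹ * D.c (x * y * p⁻¹) p)⁻¹ = coboundary D.c x y z := by
  have k1 : D.ρ (y * z * q⁻¹) = 1 := by simp [hq]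
  have k1' : D.ρ (x * (y * z * q⁻¹) * x⁻¹) = 1 := by simp [hq]
  have k2 : D.ρ (x * q * r⁻¹) = 1 := by simp [hq, hr, mul_assoc]
  have k3 : D.ρ (p * z * r⁻¹) = 1 := by simp [hp, hr]
  have k4 : D.ρ (x * y * p⁻¹) = 1 := by simp [hp]
  have h1 := D.c_assoc (x := x) (y := y * z * q⁻¹) (z := q) (Or.inr (Or.inl k1))
  have h2 := D.c_assoc (x := x * (y * z * q⁻¹) * x⁻¹) (y := x) (z := q) (Or.inl k1')
  have h3 := D.c_assoc (x := x * (y * z * q⁻¹) * x⁻¹) (y := x * q * r⁻¹) (z := r) (Or.inl k1')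
  have h4 := D.c_assoc (x := x * y * p⁻¹) (y := p) (z := z) (Or.inl k4)
  have h5 := D.c_assoc (x := x * y * p⁻¹) (y := p * z * r⁻¹) (z := r) (Or.inl k4)
  rw [D.c_ker _ _ k1' k2] at h3
  rw [D.c_ker _ _ k4 k3] at h5
  -- The two products of defects are the same element of `K`; `h3` and `h5` expand its value of `c`
  -- against `r` in two ways, which links the two sides of the anomaly.
  have e : x * (y * z * q⁻¹) * x⁻¹ * (x * q * r⁻¹) = x * y * p⁻¹ * (p * z * r⁻¹) := by group
  rw [e] at h3
  rw [inv_mul_cancel_right] at h1 h2 h3 h4 h5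
  simp only [χ, coboundary]
  apply Additive.ofMul.injective
  replace h1 := congrArg Additive.ofMul h1
  replace h2 := congrArg Additive.ofMul h2
  replace h3 := congrArg Additive.ofMul h3
  replace h4 := congrArg Additive.ofMul h4
  replace h5 := congrArg Additive.ofMul h5
  simp only [ofMul_mul, ofMul_inv, ofMul_one] at h1 h2 h3 h4 h5 ⊢
  grind

theorem incl_injective : Function.Injective D.incl := Subtype.val_injective

theorem ρ_incl (k : D.K) : D.ρ (D.incl k) = 1 := k.2

theorem incl_conj (g : G) (k : D.K) :
    D.incl (D.conj g k) = D.sec g * D.incl k * (D.sec g)⁻¹ := rfl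

theorem incl_defect (g h : G) :
    D.incl (D.defect g h) = D.sec g * D.sec h * (D.sec (g * h))⁻¹ := rfl

theorem conj_mul (g : G) (k l : D.K) : D.conj g (k * l) = D.conj g k * D.conj g l :=
  D.incl_injective (by simp only [map_mul, incl_conj]; group)

theorem conj_one (g : G) : D.conj g 1 = 1 :=
  D.incl_injective (by simp only [map_one, incl_conj]; group)

theorem conj_injective (g : G) : Function.Injective (D.conj g) := fun k l h =>
  D.incl_injective (by
    have h' := congrArg D.incl h
    simpa only [incl_conj, mul_left_inj, mul_right_inj] using h')

theorem conj_bijective (g : G) : Function.Bijective (D.conj g) :=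
  Finite.injective_iff_bijective.1 (D.conj_injective g)

theorem conj_conj (g h : G) (k : D.K) :
    D.conj g (D.conj h k) = D.defect g h * D.conj (g * h) k * (D.defect g h)⁻¹ :=
  D.incl_injective (by simp only [map_mul, map_inv, incl_conj, incl_defect]; group)

/-- The images of the unitaries `v_k` under the model automorphism at `g`. -/
def twistedV (g : G) : D.K →* unitary D.Alg where
  toFun k := ⟨crossedProduct.phaseV D.π (D.χ (D.sec g) (D.incl k)) (D.conj g k),
    crossedProduct.phaseV_mem_unitary ..⟩
  map_one' := Subtype.ext (by
    simp [crossedProduct.phaseV_one, conj_one, χ, D.c_one_left, D.c_one_right])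
  map_mul' k l := Subtype.ext (by
    rw [Submonoid.coe_mul, crossedProduct.phaseV_mul, map_mul,
      D.χ_mul _ (D.ρ_incl k) (D.ρ_incl l), conj_mul])

theorem π_conj_sec (g : G) (k : D.K) (b : UHF D.Γ) :
    D.π (D.conj g k) (tensorAction (D.sec g) b) = tensorAction (D.sec g) (D.π k b) := by
  change (tensorAction (D.incl (D.conj g k)) * tensorAction (D.sec g)) b =
    (tensorAction (D.sec g) * tensorAction (D.incl k)) b
  rw [← map_mul, ← map_mul, incl_conj, inv_mul_cancel_right]

/-- The model automorphism at `g`, as an endomorphism. -/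
def autHom (g : G) : D.Alg →⋆ₐ[ℂ] D.Alg :=
  crossedProduct.lift D.π
    ((crossedProduct.ofHom D.π).comp (tensorAction (D.sec g) : UHF D.Γ →⋆ₐ[ℂ] UHF D.Γ))
    (D.twistedV g) fun k b => by
      change crossedProduct.phaseV D.π _ _ * crossedProduct.of D.π _ =
        crossedProduct.of D.π (tensorAction (D.sec g) (D.π k b)) * crossedProduct.phaseV D.π _ _
      rw [crossedProduct.phaseV_mul_of]
      congr 2
      exact D.π_conj_sec g k b

theorem autHom_of (g : G) (b : UHF D.Γ) :
    D.autHom g (crossedProduct.of D.π b) = crossedProduct.of D.π (tensorAction (D.sec g) b) :=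
  crossedProduct.lift_of ..

theorem autHom_v (g : G) (k : D.K) :
    D.autHom g (crossedProduct.v D.π k) =
      crossedProduct.phaseV D.π (D.χ (D.sec g) (D.incl k)) (D.conj g k) :=
  crossedProduct.lift_v ..

theorem autHom_phaseV (g : G) (z : Circle) (k : D.K) :
    D.autHom g (crossedProduct.phaseV D.π z k) =
      crossedProduct.phaseV D.π (z * D.χ (D.sec g) (D.incl k)) (D.conj g k) := by
  rw [crossedProduct.phaseV, map_smul, autHom_v, crossedProduct.phaseV, smul_smul,
    ← Circle.coe_mul, crossedProduct.phaseV]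

theorem autHom_elt (g : G) (a : D.K → UHF D.Γ) : D.autHom g (D.elt a) = D.autFormula g a := by
  refine (crossedProduct.lift_sum ..).trans (Finset.sum_congr rfl fun k _ => ?_)
  exact mul_smul_comm _ _ _

/-- The map only permutes the coefficients by `k ↦ ĝkĝ⁻¹`, applies an automorphism to each and
multiplies by phases. -/
theorem autHom_injective (g : G) : Function.Injective (D.autHom g) := by
  refine (injective_iff_map_eq_zero _).2 fun x hx => ?_
  obtain ⟨a, rfl⟩ := crossedProduct.sum_surjective _ x
  let e : D.K ≃ D.K := Equiv.ofBijective _ (D.conj_bijective g)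
  let a' : D.K → UHF D.Γ := fun l => (D.χ (D.sec g) (D.incl (e.symm l)) : ℂ) •
    tensorAction (D.sec g) (a (e.symm l))
  have h : D.autHom g (crossedProduct.sum D.π a) = crossedProduct.sum D.π a' := by
    refine (D.autHom_elt g a).trans ?_
    rw [crossedProduct.sum, ← Equiv.sum_comp e]
    refine Finset.sum_congr rfl fun k _ => ?_
    simp only [a', Equiv.symm_apply_apply]
    rw [← crossedProduct.ofHom_apply, ← crossedProduct.ofHom_apply, map_smul, smul_mul_assoc]
    rfl
  rw [h] at hx
  have ha' : a' = 0 := (crossedProduct.sumEquiv D.π).map_eq_zero_iff.1 hx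
  have ha : a = 0 := by
    funext k
    have hk := congrFun ha' (e k)
    simp only [a', Equiv.symm_apply_apply, Pi.zero_apply, smul_eq_zero, Circle.coe_ne_zero,
      false_or] at hk
    simpa using hk
  rw [ha]
  exact (crossedProduct.sumEquiv D.π).map_zero

theorem autHom_surjective (g : G) : Function.Surjective (D.autHom g) := by
  intro x
  change x ∈ (D.autHom g).range
  induction x using crossedProduct.induction with
  | hadd x y hx hy => exact add_mem hx hy
  | h b k =>
    refine mul_mem ⟨crossedProduct.of D.π ((tensorAction (D.sec g)).symm b), ?_⟩ ?_
    · change D.autHom g _ = _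
      rw [autHom_of]
      simp
    · obtain ⟨l, rfl⟩ := (D.conj_bijective g).2 k
      refine ⟨crossedProduct.phaseV D.π (D.χ (D.sec g) (D.incl l))⁻¹ l, ?_⟩
      change D.autHom g _ = _
      rw [autHom_phaseV, inv_mul_cancel, crossedProduct.phaseV, Circle.coe_one, one_smul]

/-- The model automorphism at `g`. -/
def aut (g : G) : D.Alg ≃⋆ₐ[ℂ] D.Alg :=
  StarAlgEquiv.ofBijective (D.autHom g) ⟨D.autHom_injective g, D.autHom_surjective g⟩

theorem aut_apply (g : G) (x : D.Alg) : D.aut g x = D.autHom g x := rfl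

/-- The scalar `η(g,h) conj(c(ĝ, ĥ)) c(κ, (gh)^)`. -/
def phase (g h : G) : Circle :=
  D.η g h * (D.c (D.sec g) (D.sec h))⁻¹ * D.c (D.incl (D.defect g h)) (D.sec (g * h))

theorem unitaryFormula_eq (g h : G) :
    D.unitaryFormula g h = crossedProduct.phaseV D.π (D.phase g h) (D.defect g h) := rfl

theorem unitaryFormula_mem (g h : G) : D.unitaryFormula g h ∈ unitary D.Alg :=
  crossedProduct.phaseV_mem_unitary ..

theorem aut_aut (g h : G) (x : D.Alg) :
    D.aut g (D.aut h x) =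
      D.unitaryFormula g h * D.aut (g * h) x * star (D.unitaryFormula g h) := by
  simp only [aut_apply]
  induction x using crossedProduct.induction with
  | hadd x y hx hy => rw [map_add, map_add, map_add, hx, hy, mul_add, add_mul]
  | h b k =>
    rw [map_mul, map_mul, map_mul, autHom_of, autHom_of, autHom_of, autHom_v, autHom_v,
      autHom_phaseV, unitaryFormula_eq, crossedProduct.star_phaseV, ← mul_assoc,
      crossedProduct.phaseV_mul_of, mul_assoc, mul_assoc, crossedProduct.phaseV_mul,
      crossedProduct.phaseV_mul, ← mul_assoc (D.defect g h), ← conj_conj]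
    congr 2
    · change (tensorAction (D.sec g) * tensorAction (D.sec h)) b =
        (tensorAction (D.incl (D.defect g h)) * tensorAction (D.sec (g * h))) b
      rw [← map_mul, ← map_mul, incl_defect, inv_mul_cancel_right]
    · have hx : D.sec g * D.sec h = D.incl (D.defect g h) * D.sec (g * h) := by
        rw [incl_defect, inv_mul_cancel_right]
      have h1 := D.χ_comp (D.sec g) (D.sec h) (D.ρ_incl k)
      rw [hx, D.χ_comp _ _ (D.ρ_incl k), D.χ_ker (D.ρ_incl _) (by simp [D.ρ_incl]), mul_one] at h1
      rw [incl_conj, ← h1, mul_left_comm, mul_inv_cancel, mul_one]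

theorem anomaly_eq (g h k : G) :
    D.aut g (D.unitaryFormula h k) * D.unitaryFormula g (h * k) *
      star (D.unitaryFormula (g * h) k) * star (D.unitaryFormula g h) =
        (ω g h k : ℂ) • (1 : D.Alg) := by
  simp only [unitaryFormula_eq, aut_apply, autHom_phaseV, crossedProduct.star_phaseV,
    crossedProduct.phaseV_mul]
  have hdef : D.conj g (D.defect h k) * D.defect g (h * k) * (D.defect (g * h) k)⁻¹ *
      (D.defect g h)⁻¹ = 1 :=
    D.incl_injective (by
      simp only [map_mul, map_inv, map_one, incl_conj, incl_defect, mul_assoc g h k]; group)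
  rw [hdef, crossedProduct.phaseV_one]
  refine congrArg (fun z : Circle => (z : ℂ) • (1 : D.Alg)) ?_
  have h1 := D.defect_scalar (x := D.sec g) (y := D.sec h) (z := D.sec k) (p := D.sec (g * h))
    (q := D.sec (h * k)) (r := D.sec (g * (h * k))) (by simp [D.ρ_sec]) (by simp [D.ρ_sec])
    (by simp [D.ρ_sec, mul_assoc])
  rw [D.coboundary_c, D.ρ_sec, D.ρ_sec, D.ρ_sec] at h1
  -- The factors `η` in the four unitaries multiply to `(dη)⁻¹`, which cancels the `dη` in `dc = ω ·
  -- dη`.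
  simp only [phase, incl_defect, coboundary, mul_assoc g h k] at h1 ⊢
  apply Additive.ofMul.injective
  replace h1 := congrArg Additive.ofMul h1
  simp only [ofMul_mul, ofMul_inv] at h1 ⊢
  grind

variable (φ : D.Alg ≃⋆ₐ[ℂ] UHF G)

/-- The model action on `M_{|G|^∞}`. -/
def action : AnomalousAction G (UHF G) where
  α g := φ.symm.trans ((D.aut g).trans φ)
  u g h := ⟨φ (D.unitaryFormula g h), by
    have h1 := D.unitaryFormula_mem g h
    rw [Unitary.mem_iff] at h1 ⊢
    rw [← map_star, ← map_mul, ← map_mul, h1.1, h1.2]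
    simp⟩
  comp_eq g h a := by
    obtain ⟨x, rfl⟩ := EquivLike.surjective φ a
    simp only [StarAlgEquiv.trans_apply, StarAlgEquiv.symm_apply_apply]
    rw [aut_aut, map_mul, map_mul, map_star]
  anomaly_scalar g h k := ⟨ω g h k, by
    simp only [StarAlgEquiv.trans_apply, StarAlgEquiv.symm_apply_apply]
    rw [← map_star, ← map_star, ← map_mul, ← map_mul, ← map_mul, anomaly_eq, map_smul, map_one]⟩

theorem isModelAction_action : D.IsModelAction φ (D.action φ) :=
  ⟨fun g a => by
    change φ (D.aut g (φ.symm (φ (D.elt a)))) = _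
    rw [StarAlgEquiv.symm_apply_apply, aut_apply, autHom_elt], fun _ _ => rfl⟩

theorem hasAnomaly_action : (D.action φ).HasAnomaly ω := fun g h k => by
  change φ (D.aut g (φ.symm (φ (D.unitaryFormula h k)))) * φ (D.unitaryFormula g (h * k)) *
    star (φ (D.unitaryFormula (g * h) k)) * star (φ (D.unitaryFormula g h)) = _
  rw [StarAlgEquiv.symm_apply_apply, ← map_star, ← map_star, ← map_mul, ← map_mul, ← map_mul,
    anomaly_eq, map_smul, map_one]

theorem eq_action {S : AnomalousAction G (UHF G)} (hS : D.IsModelAction φ S) :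
    S = D.action φ := by
  have hα : S.α = (D.action φ).α := by
    funext g
    ext x
    obtain ⟨y, rfl⟩ := EquivLike.surjective φ x
    obtain ⟨a, rfl⟩ := crossedProduct.sum_surjective _ y
    exact (hS.1 g a).trans ((D.isModelAction_action φ).1 g a).symm
  have hu : S.u = (D.action φ).u := by
    funext g h
    exact Subtype.ext (hS.2 g h)
  cases S
  cases hα
  cases hu
  rfl

end ModelData

/-! ### The Rokhlin property of the model action -/

section AsymptoticCommutant

open Filter Topology

variable {M : Type u} [CStarAlgebra M]

/-- The elements that commute asymptotically with a bounded sequence of self-adjoint elements. -/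
def asymptoticCommutant (E : ℕ → M) (hE : ∀ n, IsSelfAdjoint (E n)) : StarSubalgebra ℂ M where
  carrier := {b | Tendsto (fun n => E n * b - b * E n) atTop (𝓝 0)}
  mul_mem' {a b} ha hb := by
    have h := (Tendsto.mul_const b ha).add (Tendsto.const_mul a hb)
    simp only [zero_mul, mul_zero, add_zero] at h
    refine h.congr fun n => ?_
    simp only [sub_mul, mul_sub, mul_assoc]
    abel
  add_mem' {a b} ha hb := by
    have h := Tendsto.add ha hb
    rw [add_zero] at h
    refine h.congr fun n => ?_
    simp only [mul_add, add_mul]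
    abel
  algebraMap_mem' z := by
    change Tendsto _ _ _
    simp [Algebra.commutes z]
  star_mem' {a} ha := by
    have h := (Tendsto.star ha).neg
    rw [star_zero, neg_zero] at h
    refine h.congr fun n => ?_
    rw [star_sub, star_mul, star_mul, (hE n).star_eq, neg_sub]

theorem isClosed_asymptoticCommutant (E : ℕ → M) (hE : ∀ n, IsSelfAdjoint (E n))
    (hb : ∀ n, ‖E n‖ ≤ 1) : IsClosed (asymptoticCommutant E hE : Set M) := by
  refine isClosed_of_closure_subset fun b hbc => ?_
  change Tendsto _ _ _
  rw [Metric.tendsto_atTop]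
  intro ε hε
  -- As `‖E n‖ ≤ 1`, replacing `b` by `a` alters the commutator by less than `2 · ε / 4`, leaving `ε
  -- / 2` for the commutator with `a`.
  obtain ⟨a, ha, hab⟩ := Metric.mem_closure_iff.1 hbc (ε / 4) (by positivity)
  replace ha : Tendsto (fun n => E n * a - a * E n) atTop (𝓝 0) := ha
  obtain ⟨N, hN⟩ := Metric.tendsto_atTop.1 ha (ε / 2) (by positivity)
  refine ⟨N, fun n hn => ?_⟩
  have h1 := hN n hn
  rw [dist_zero_right] at h1 ⊢
  rw [dist_eq_norm] at hab
  have h2 : E n * b - b * E n =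
      (E n * a - a * E n) + (E n * (b - a) - (b - a) * E n) := by
    simp only [mul_sub, sub_mul]; abel
  have h3 : ‖E n * (b - a)‖ ≤ ‖b - a‖ := (norm_mul_le _ _).trans
    (mul_le_of_le_one_left (norm_nonneg _) (hb n))
  have h4 : ‖(b - a) * E n‖ ≤ ‖b - a‖ := (norm_mul_le _ _).trans
    (mul_le_of_le_one_right (norm_nonneg _) (hb n))
  rw [h2]
  linarith [norm_add_le (E n * a - a * E n) (E n * (b - a) - (b - a) * E n),
    norm_sub_le (E n * (b - a)) ((b - a) * E n)]

end AsymptoticCommutant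

/-! ### Projections in the sequence algebra. -/

section SeqAlg

open Filter Topology

variable {A : Type u} [CStarAlgebra A]

theorem SeqAlg.mk_eq_mk {f g : ℕ →ᵇ A} :
    SeqAlg.mk A f = SeqAlg.mk A g ↔ Tendsto (fun n => f n - g n) atTop (𝓝 0) :=
  Ideal.Quotient.eq

theorem SeqAlg.map_mk (θ : A ≃⋆ₐ[ℂ] A) (f : ℕ →ᵇ A) :
    SeqAlg.map θ (SeqAlg.mk A f) = SeqAlg.mk A (boundedMap θ f) := rfl

/-- A sequence of projections, as a bounded sequence. -/
def projSeq (q : ℕ → A) (hq : ∀ n, IsStarProjection (q n)) : ℕ →ᵇ A :=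
  BoundedContinuousFunction.ofNormedAddCommGroupDiscrete q 1
    fun n => (hq n).norm_le

theorem isStarProjection_mk_projSeq (q : ℕ → A) (hq : ∀ n, IsStarProjection (q n)) :
    IsStarProjection (SeqAlg.mk A (projSeq q hq)) where
  isIdempotentElem := by
    rw [IsIdempotentElem, ← map_mul]
    congr 1
    ext n
    exact (hq n).isIdempotentElem
  isSelfAdjoint := by
    rw [IsSelfAdjoint, SeqAlg.star_mk]
    congr 1
    ext n
    exact (hq n).isSelfAdjoint

theorem mk_projSeq_mem_centralSequences (q : ℕ → A) (hq : ∀ n, IsStarProjection (q n))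
    (h : ∀ a, Tendsto (fun n => a * q n - q n * a) atTop (𝓝 0)) :
    SeqAlg.mk A (projSeq q hq) ∈ centralSequences A := by
  rw [centralSequences, Subring.mem_centralizer_iff]
  rintro _ ⟨a, rfl⟩
  dsimp only
  rw [← map_mul, ← map_mul, SeqAlg.mk_eq_mk]
  exact h a

end SeqAlg

/-! ### Rokhlin projections from the fibres of `ρ`. -/

namespace ModelData

open Filter Topology

variable {G : Type u} [Group G] [Fintype G] {ω : G → G → G → Circle} (D : ModelData G ω)

open Classical in
/-- The projection of `ℓ²(Γ)` onto `ℓ²(ρ⁻¹(g))` in the `n`-th tensor factor. -/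
def fiberProj (g : G) (n : ℕ) : UHF D.Γ :=
  UHF.mk (site n (Matrix.diagonal fun γ => if D.ρ γ = g then 1 else 0)) (site_mem _ _)

open Classical in
theorem toOp_fiberProj_apply (g : G) (n : ℕ) (ξ : TensorSpace D.Γ) (x : ℕ → D.Γ) :
    (D.fiberProj g n).toOp ξ x = if D.ρ (x n) = g then ξ x else 0 := by
  rw [fiberProj, UHF.toOp_mk, site_apply, Finset.sum_eq_single (x n)]
  · simp
  · intro γ _ hγ
    rw [Matrix.diagonal_apply_ne _ hγ.symm, zero_mul]
  · simp

open Classical in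
theorem isSelfAdjoint_toOp_fiberProj (g : G) (n : ℕ) :
    IsSelfAdjoint (D.fiberProj g n).toOp := by
  have h : (D.fiberProj g n).toOp = mulOp (fun x => if D.ρ (x n) = g then 1 else 0) 1 zero_le_one
      (fun x => by split_ifs <;> simp) := by
    ext ξ x
    rw [toOp_fiberProj_apply]
    simp
  rw [h]
  exact isSelfAdjoint_mulOp _ _ _ _ fun x => by split_ifs <;> simp

theorem isStarProjection_fiberProj (g : G) (n : ℕ) : IsStarProjection (D.fiberProj g n) where
  isIdempotentElem := UHF.toOp_injective (by
    rw [map_mul]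
    ext ξ x
    rw [mul_apply_eq_comp, toOp_fiberProj_apply, toOp_fiberProj_apply]
    split_ifs <;> rfl)
  isSelfAdjoint := UHF.toOp_injective (by
    rw [map_star]
    exact D.isSelfAdjoint_toOp_fiberProj g n)

theorem sum_fiberProj (n : ℕ) : ∑ g, D.fiberProj g n = 1 := by
  classical
  refine UHF.toOp_injective ?_
  rw [map_sum, map_one]
  ext ξ x
  simp only [sum_apply, lp.coeFn_sum, Finset.sum_apply, toOp_fiberProj_apply]
  simp

theorem tensorAction_fiberProj (γ : D.Γ) (g : G) (n : ℕ) :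
    tensorAction γ (D.fiberProj g n) = D.fiberProj (D.ρ γ * g) n := by
  classical
  refine UHF.toOp_injective ?_
  rw [UHF.toOp_tensorAction, ← Unitary.coe_star, Unitary.star_eq_inv, ← map_inv]
  ext ξ x
  rw [mul_apply_eq_comp, mul_apply_eq_comp, diagShift_apply, toOp_fiberProj_apply,
    toOp_fiberProj_apply, diagShift_apply]
  simp only [inv_inv, mul_inv_cancel_left]
  refine if_congr ?_ rfl rfl
  rw [map_mul, map_inv, inv_mul_eq_iff_eq_mul]

/-- The commutator with `r_i(T)` vanishes once `n > i`, and the asymptotic commutant of a bounded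
sequence is closed. -/
theorem tendsto_commutator_fiberProj (g : G) (b : UHF D.Γ) :
    Tendsto (fun n => D.fiberProj g n * b - b * D.fiberProj g n) atTop (𝓝 0) := by
  have hle : tensorAlgebra D.Γ ≤ asymptoticCommutant (fun n => (D.fiberProj g n).toOp)
      (D.isSelfAdjoint_toOp_fiberProj g) := by
    refine StarSubalgebra.topologicalClosure_minimal (StarAlgebra.adjoin_le ?_)
      (isClosed_asymptoticCommutant _ _ fun n =>
        ((D.isStarProjection_fiberProj g n).map UHF.toOp).norm_le)
    rintro _ ⟨i, T, rfl⟩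
    refine tendsto_const_nhds.congr' ?_
    filter_upwards [eventually_gt_atTop i] with n hn
    refine (sub_eq_zero.2 ?_).symm
    ext ξ x
    rw [mul_apply_eq_comp, mul_apply_eq_comp, toOp_fiberProj_apply, site_apply, site_apply]
    have hx : ∀ γ, Function.update x i γ n = x n := fun γ => Function.update_of_ne hn.ne' _ _
    split_ifs with h
    · exact Finset.sum_congr rfl fun γ _ => by rw [toOp_fiberProj_apply, hx, if_pos h]
    · exact (Finset.sum_eq_zero fun γ _ => by
        rw [toOp_fiberProj_apply, hx, if_neg h, mul_zero]).symm
  have h : Tendsto (fun n => (D.fiberProj g n).toOp * b.toOp - b.toOp * (D.fiberProj g n).toOp)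
      atTop (𝓝 0) := hle b.toOp_mem
  have hiso := NonUnitalStarAlgHom.isometry (UHF.toOp (Γ := D.Γ)) UHF.toOp_injective
  rw [hiso.isEmbedding.tendsto_nhds_iff, map_zero]
  refine h.congr fun n => ?_
  simp

variable (φ : D.Alg ≃⋆ₐ[ℂ] UHF G)

/-- The inclusion of `⨂ 𝓑(ℓ²(Γ))` in `M_{|G|^∞}` given by an identification `φ`. -/
def inclUHF : UHF D.Γ →⋆ₐ[ℂ] UHF G := (φ : D.Alg →⋆ₐ[ℂ] UHF G).comp (crossedProduct.ofHom D.π)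

theorem inclUHF_apply (b : UHF D.Γ) : D.inclUHF φ b = φ (crossedProduct.of D.π b) := rfl

theorem tendsto_commutator_inclUHF (g : G) (y : UHF G) :
    Tendsto (fun n => y * D.inclUHF φ (D.fiberProj g n) - D.inclUHF φ (D.fiberProj g n) * y)
      atTop (𝓝 0) := by
  obtain ⟨x, rfl⟩ := EquivLike.surjective φ y
  induction x using crossedProduct.induction with
  | hadd x y hx hy =>
    have h := hx.add hy
    rw [add_zero] at h
    refine h.congr fun n => ?_
    rw [map_add, add_mul, mul_add]
    abel
  | h b k =>
    have hcont : Continuous (D.inclUHF φ) :=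
      AddMonoidHomClass.continuous_of_bound (D.inclUHF φ) 1 fun b => by
        simpa using NonUnitalStarAlgHom.norm_apply_le (D.inclUHF φ) b
    have h := (((hcont.tendsto 0).comp (D.tendsto_commutator_fiberProj g b)).mul_const
      (φ (crossedProduct.v D.π k))).neg
    rw [map_zero, zero_mul, neg_zero] at h
    refine h.congr fun n => ?_
    -- `π_k` sends the projection for `g` to the one for `ρ(k) g = g`, so it commutes with `v_k`
    -- exactly.
    have hv : crossedProduct.v D.π k * crossedProduct.of D.π (D.fiberProj g n) =
        crossedProduct.of D.π (D.fiberProj g n) * crossedProduct.v D.π k := by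
      rw [crossedProduct.v_mul_of]
      congr 2
      have h1 := D.tensorAction_fiberProj (D.incl k) g n
      rwa [D.ρ_incl, one_mul] at h1
    have hv' := congrArg φ hv
    rw [map_mul, map_mul] at hv'
    simp only [Function.comp_apply, map_sub, map_mul, inclUHF_apply]
    rw [sub_mul, neg_sub, mul_assoc (φ _) (φ (crossedProduct.v D.π k)), hv', mul_assoc, mul_assoc]

theorem hasRokhlinProperty_action : (D.action φ).HasRokhlinProperty := by
  have hq : ∀ g n, IsStarProjection (D.inclUHF φ (D.fiberProj g n)) := fun g n =>
    (D.isStarProjection_fiberProj g n).map (D.inclUHF φ)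
  refine ⟨fun g => SeqAlg.mk _ (projSeq _ (hq g)), fun g => ?_, fun g => ?_, ?_, fun g h => ?_⟩
  · exact mk_projSeq_mem_centralSequences _ _ (D.tendsto_commutator_inclUHF φ g)
  · exact isStarProjection_mk_projSeq _ _
  · rw [← map_sum, ← map_one (SeqAlg.mk (UHF G))]
    congr 1
    ext n
    have h := congrArg (D.inclUHF φ) (D.sum_fiberProj n)
    rw [map_sum, map_one] at h
    rw [BoundedContinuousFunction.coe_sum, Finset.sum_apply]
    exact h
  · rw [SeqAlg.map_mk]
    congr 1
    ext n
    change φ (D.aut g (φ.symm (φ (crossedProduct.of D.π (D.fiberProj h n))))) =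
      φ (crossedProduct.of D.π (D.fiberProj (g * h) n))
    rw [StarAlgEquiv.symm_apply_apply, aut_apply, autHom_of, tensorAction_fiberProj, D.ρ_sec]

end ModelData

end Anomalous

end

theorem mainTheorem11 {G : Type u} [Group G] [Fintype G] (ω : G → G → G → Circle)
    (hω : Anomalous.IsThreeCocycle ω) :
    (∃ D : Anomalous.ModelData G ω, Anomalous.IsNormalized ω → ∀ g h, D.η g h = 1) ∧
      ∀ D : Anomalous.ModelData G ω,
        Nonempty (D.Alg ≃⋆ₐ[ℂ] Anomalous.UHF G) ∧
          ∀ φ : D.Alg ≃⋆ₐ[ℂ] Anomalous.UHF G,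
            (∃! S : Anomalous.AnomalousAction G (Anomalous.UHF G), D.IsModelAction φ S) ∧
              ∀ S : Anomalous.AnomalousAction G (Anomalous.UHF G), D.IsModelAction φ S →
                S.HasAnomaly ω ∧ S.HasRokhlinProperty := by
  refine ⟨Anomalous.exists_modelData ω hω, fun D => ⟨D.nonempty_equiv, fun φ => ⟨?_, ?_⟩⟩⟩
  · exact ⟨D.action φ, D.isModelAction_action φ, fun S hS => D.eq_action φ hS⟩
  · intro S hS
    rw [D.eq_action φ hS]
    exact ⟨D.hasAnomaly_action φ, D.hasRokhlinProperty_action φ⟩
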